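/- Let $\rho\in(-1,1)$, $\sigma>0$, $\beta\ge 0$ and $\bar\rho=\sqrt{1-\rho^2}$; powers of $x$ are understood as powers of $|x|$. \textbf{The forms.} A function on a product of open intervals is here differentiated along the coordinate lines: it is required to have, on almost every line parallel to an axis, a (locally) absolutely continuous version, and $\partial_x u,\partial_y u$ are the derivatives of these versions. Set $$\Gamma(u,v)=y^2\bigl(|x|^{2\beta}\partial_xu\,\partial_xv+\rho|x|^{\beta}(\partial_xu\,\partial_yv+\partial_yu\,\partial_xv)+\partial_yu\,\partial_yv\bigr)\quad\text{on }S=\mathbb R\times(0,\infty),$$ $$\widetilde\Gamma(u,v)=|x|^{2\beta}\partial_xu\,\partial_xv+\rho|x|^{\beta}(\partial_xu\,\partial_yv+\partial_yu\,\partial_xv)+\partial_yu\,\partial_yv\quad\text{on }\mathbb R^2,$$ $$\Gamma^c(u,v)=\sigma^2|x|^{2\beta}\,\partial_xu\,\partial_xv\quad\text{on }\mathbb R,$$ and consider the measures $m_j=\frac{dx\,dy}{\bar\rho\,|x|^{\beta(1+j)}y^2}$ on $S$, $\widetilde m_j=\frac{dx\,dy}{\bar\rho\,|x|^{\beta(1+j)}}$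 on $\mathbb R^2$ ($j=0,1$), and $m_\beta=|x|^{-2\beta}dx$ on $\mathbb R$. For $(G,m)$ equal to $(\Gamma,m_j)$, $(\widetilde\Gamma,\widetilde m_j)$ or $(\Gamma^c,m_\beta)$ let $\mathcal E(u,v)=\frac12\int G(u,v)\,dm$, with domain $D(\mathcal E)$ the set of all $u\in L^2(m)$ that have absolutely continuous versions on almost all coordinate lines and satisfy $G(u,u)\in L^1(m)$. These are the SABR, the time-changed SABR and the CEV form. \textbf{Claim.} Assume $\beta<1$ if $j=0$ and $\beta<\frac12$ if $j=1$, in the first two cases, and $\beta<\frac12$ in the CEV case. (a) Each $(\mathcal E,D(\mathcal E))$ is a Dirichlet form on $L^2(m)$ which admits a carré du champ operator (energy measure), and this operator is $G$. That is: there is a subspace $H\subset D(\mathcal E)\cap L^\infty$, dense in $D(\mathcal E)$ for the norm $(\mathcal E(u,u)+\|u\|^2_{L^2(m)})^{1/2}$, such that for all $f\in H$ one has $G(f,f)\in L^1(m)$ and $2\mathcal E(fh,f)-\mathcal E(h,f^2)=\int h\,G(f,f)\,dm$ for all $h\in D(\mathcal E)\cap L^\infty$; and $G$ is the unique positive symmetric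 continuous bilinear map $D(\mathcal E)\times D(\mathcal E)\to L^1(m)$ with $$\mathcal E(fh,g)+\mathcal E(gh,f)-\mathcal E(h,fg)=\int h\,G(f,g)\,dm\qquad\text{for all }f,g,h\in D(\mathcal E)\cap L^\infty .$$ (b) Away from the axis $\{x=0\}$, these operators are given by the gradients of the Riemannian metrics $$g=\frac1{1-\rho^2}\Bigl(\frac{dx^2}{y^2|x|^{2\beta}}-\frac{2\rho\,dx\,dy}{y^2|x|^\beta}+\frac{dy^2}{y^2}\Bigr)\ \text{ on }\{x\ne0,\ y>0\},$$ $$\tilde g=\frac1{1-\rho^2}\Bigl(\frac{dx^2}{|x|^{2\beta}}-\frac{2\rho\,dx\,dy}{|x|^\beta}+dy^2\Bigr)\ \text{ on }\{x\ne0\},\qquad g_c=\frac{dx^2}{\sigma^2|x|^{2\beta}}\ \text{ on }\{x\neq0\},$$ respectively. With $\nabla$ the Riemannian gradient of the respective metric (so that $\langle\nabla u,w\rangle=du(w)$ for all tangent vectors $w$), one has $G(u,v)=\langle\nabla u,\nabla v\rangle$, and in particular $G(u,u)=|\nabla u|^2$: at every point where $u,v$ are differentiable, with classical derivatives, and almost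 everywhere for $u,v\in D(\mathcal E)$. -/

import Mathlib

open MeasureTheory Filter Topology

noncomputable section

/-! ### Dirichlet forms and their carré du champ on `L²(μ)`

Forms are given on square integrable functions (representatives of classes in `L²(μ)`); invariance
under modification on `μ`-null sets is part of the definition. -/

section Abstract

variable {Ω : Type*} [MeasurableSpace Ω]

/-- The square of the norm `‖u‖_{ℰ₁}`, namely `ℰ(u,u) + ‖u‖²_{L²(μ)}`. -/
def energyNormSq (μ : Measure Ω) (𝓔 : (Ω → ℝ) → (Ω → ℝ) → ℝ) (u : Ω → ℝ) : ℝ :=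
  𝓔 u u + ∫ z, (u z) ^ 2 ∂μ

/-- `(𝓔, D)` is a (symmetric) Dirichlet form on `L²(μ)`: a densely defined, nonnegative, symmetric
bilinear form, complete for the norm `‖·‖_{ℰ₁}`, and Markovian. -/
structure IsDirichletForm (μ : Measure Ω) (D : Set (Ω → ℝ)) (𝓔 : (Ω → ℝ) → (Ω → ℝ) → ℝ) :
    Prop where
  memLp : ∀ u ∈ D, MemLp u 2 μ
  mem_congr : ∀ u ∈ D, ∀ v : Ω → ℝ, u =ᵐ[μ] v → v ∈ D
  form_congr : ∀ u ∈ D, ∀ v ∈ D, ∀ w ∈ D, u =ᵐ[μ] v → 𝓔 u w = 𝓔 v w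
  zero_mem : (0 : Ω → ℝ) ∈ D
  add_mem : ∀ u ∈ D, ∀ v ∈ D, u + v ∈ D
  smul_mem : ∀ (c : ℝ), ∀ u ∈ D, c • u ∈ D
  dense : ∀ u : Ω → ℝ, MemLp u 2 μ → ∀ ε > 0, ∃ v ∈ D, ∫ z, (u z - v z) ^ 2 ∂μ < ε
  add_left : ∀ u ∈ D, ∀ v ∈ D, ∀ w ∈ D, 𝓔 (u + v) w = 𝓔 u w + 𝓔 v w
  smul_left : ∀ (c : ℝ), ∀ u ∈ D, ∀ v ∈ D, 𝓔 (c • u) v = c * 𝓔 u v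
  symm : ∀ u ∈ D, ∀ v ∈ D, 𝓔 u v = 𝓔 v u
  nonneg : ∀ u ∈ D, 0 ≤ 𝓔 u u
  complete : ∀ u : ℕ → Ω → ℝ, (∀ n, u n ∈ D) →
    (∀ ε > 0, ∃ N, ∀ m ≥ N, ∀ n ≥ N, energyNormSq μ 𝓔 (u m - u n) < ε) →
    ∃ w ∈ D, Tendsto (fun n => energyNormSq μ 𝓔 (u n - w)) atTop (𝓝 0)
  markov_mem : ∀ u ∈ D, (fun z => min (max (u z) 0) 1) ∈ D
  markov_le : ∀ u ∈ D,
    𝓔 (fun z => min (max (u z) 0) 1) (fun z => min (max (u z) 0) 1) ≤ 𝓔 u u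

/-- `Γ : D × D → L¹(μ)` is a positive, symmetric, continuous bilinear map with
`ℰ(fh,g) + ℰ(gh,f) - ℰ(h,fg) = ∫ h Γ(f,g) dμ` for all `f, g, h ∈ D ∩ L^∞(μ)`. -/
structure IsCarreDuChampOperator (μ : Measure Ω) (D : Set (Ω → ℝ))
    (𝓔 : (Ω → ℝ) → (Ω → ℝ) → ℝ) (Γ : (Ω → ℝ) → (Ω → ℝ) → Ω → ℝ) : Prop where
  integrable : ∀ u ∈ D, ∀ v ∈ D, Integrable (Γ u v) μ
  add_left : ∀ u ∈ D, ∀ v ∈ D, ∀ w ∈ D, Γ (u + v) w =ᵐ[μ] Γ u w + Γ v w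
  smul_left : ∀ (c : ℝ), ∀ u ∈ D, ∀ v ∈ D, Γ (c • u) v =ᵐ[μ] c • Γ u v
  symm : ∀ u ∈ D, ∀ v ∈ D, Γ u v =ᵐ[μ] Γ v u
  nonneg : ∀ u ∈ D, 0 ≤ᵐ[μ] Γ u u
  continuous : ∀ (u v : ℕ → Ω → ℝ), (∀ n, u n ∈ D) → (∀ n, v n ∈ D) → ∀ a ∈ D, ∀ b ∈ D,
    Tendsto (fun n => energyNormSq μ 𝓔 (u n - a)) atTop (𝓝 0) →
    Tendsto (fun n => energyNormSq μ 𝓔 (v n - b)) atTop (𝓝 0) →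
    Tendsto (fun n => ∫ z, |Γ (u n) (v n) z - Γ a b z| ∂μ) atTop (𝓝 0)
  characterization : ∀ f ∈ D, MemLp f ⊤ μ → ∀ g ∈ D, MemLp g ⊤ μ → ∀ h ∈ D, MemLp h ⊤ μ →
    𝓔 (f * h) g + 𝓔 (g * h) f - 𝓔 h (f * g) = ∫ z, h z * Γ f g z ∂μ

/-- `(𝓔, D)` is a Dirichlet form on `L²(μ)` that admits a carré du champ operator (energy measure),
and this operator is `Γ`. -/
structure HasEnergyMeasure (μ : Measure Ω) (D : Set (Ω → ℝ))
    (𝓔 : (Ω → ℝ) → (Ω → ℝ) → ℝ) (Γ : (Ω → ℝ) → (Ω → ℝ) → Ω → ℝ) : Prop where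
  isDirichletForm : IsDirichletForm μ D 𝓔
  /-- There is a subspace `H` of `D ∩ L^∞(μ)`, dense in `D`, such that for each `f ∈ H` the function
  `Γ(f,f) ∈ L¹(μ)` represents `h ↦ 2ℰ(fh,f) - ℰ(h,f²)` on `D ∩ L^∞(μ)`. -/
  admits : ∃ H : Submodule ℝ (Ω → ℝ),
    (∀ f ∈ H, f ∈ D ∧ MemLp f ⊤ μ) ∧
    (∀ u ∈ D, ∀ ε > 0, ∃ f ∈ H, energyNormSq μ 𝓔 (u - f) < ε) ∧
    ∀ f ∈ H, Integrable (Γ f f) μ ∧ ∀ h ∈ D, MemLp h ⊤ μ →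
      2 * 𝓔 (f * h) f - 𝓔 h (f ^ 2) = ∫ z, h z * Γ f f z ∂μ
  isOperator : IsCarreDuChampOperator μ D 𝓔 Γ
  unique : ∀ Γ' : (Ω → ℝ) → (Ω → ℝ) → Ω → ℝ, IsCarreDuChampOperator μ D 𝓔 Γ' →
    ∀ u ∈ D, ∀ v ∈ D, Γ' u v =ᵐ[μ] Γ u v

end Abstract

/-! ### Riemannian metrics on open subsets of a vector space -/

section Riemannian

variable {E : Type*} [NormedAddCommGroup E] [NormedSpace ℝ E]

/-- `z ↦ g z` is a smooth Riemannian metric on the open set `U`. -/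
structure IsRiemannianMetricOn (U : Set E) (g : E → E → E → ℝ) : Prop where
  isOpen : IsOpen U
  add_left : ∀ z ∈ U, ∀ v v' w, g z (v + v') w = g z v w + g z v' w
  smul_left : ∀ z ∈ U, ∀ (c : ℝ) (v w), g z (c • v) w = c * g z v w
  symm : ∀ z ∈ U, ∀ v w, g z v w = g z w v
  pos : ∀ z ∈ U, ∀ v, v ≠ 0 → 0 < g z v v
  smooth : ∀ v w, ContDiffOn ℝ ((⊤ : ℕ∞) : WithTop ℕ∞) (fun z => g z v w) U

/-- `X` is the Riemannian gradient at `z` of a function with differential `ξ` at `z`. -/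
def IsRiemannianGradient (g : E → E → E → ℝ) (z : E) (ξ : E →L[ℝ] ℝ) (X : E) : Prop :=
  ∀ w : E, g z X w = ξ w

end Riemannian

/-! ### Differentials along coordinate lines -/

/-- On the open interval `I`, `f` has a (locally) absolutely continuous version, with derivative `g`
almost everywhere. -/
def HasACDerivOn (I : Set ℝ) (f g : ℝ → ℝ) : Prop :=
  ∃ v : ℝ → ℝ, (∀ a ∈ I, ∀ b ∈ I, AbsolutelyContinuousOnInterval v a b) ∧
    f =ᵐ[volume.restrict I] v ∧ ∀ᵐ s ∂volume.restrict I, HasDerivAt v (g s) s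

/-- On `ℝ × J`, the function `u` has absolutely continuous versions on almost all lines parallel to
the axes, and the components of `G` are the resulting partial derivatives `∂ₓu` and `∂_y u`. -/
def HasACGradient (J : Set ℝ) (u : ℝ × ℝ → ℝ) (G : ℝ × ℝ → ℝ × ℝ) : Prop :=
  Measurable G ∧
  (∀ᵐ y ∂volume.restrict J,
    HasACDerivOn Set.univ (fun x => u (x, y)) (fun x => (G (x, y)).1)) ∧
  (∀ᵐ x, HasACDerivOn J (fun y => u (x, y)) (fun y => (G (x, y)).2))

open Classical in
/-- The pair `(∂ₓu, ∂_y u)`; it is unique up to null sets in `ℝ × J`. -/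
def acGradient (J : Set ℝ) (u : ℝ × ℝ → ℝ) : ℝ × ℝ → ℝ × ℝ :=
  if h : ∃ G, HasACGradient J u G then h.choose else 0

/-- The differential `du = ∂ₓu dx + ∂_y u dy`. -/
def acDifferential (J : Set ℝ) (u : ℝ × ℝ → ℝ) (z : ℝ × ℝ) : ℝ × ℝ →L[ℝ] ℝ :=
  (acGradient J u z).1 • ContinuousLinearMap.fst ℝ ℝ ℝ +
    (acGradient J u z).2 • ContinuousLinearMap.snd ℝ ℝ ℝ

open Classical in
/-- The derivative `∂ₓu` of a function on the line with an absolutely continuous version; it is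
unique up to null sets. -/
def acDeriv (u : ℝ → ℝ) : ℝ → ℝ :=
  if h : ∃ g, Measurable g ∧ HasACDerivOn Set.univ u g then h.choose else 0

/-- The differential `du = ∂ₓu dx`. -/
def acDifferentialLine (u : ℝ → ℝ) (x : ℝ) : ℝ →L[ℝ] ℝ :=
  acDeriv u x • ContinuousLinearMap.id ℝ ℝ

/-- The form `ℰ(u,v) = ½ ∫ Γ(u,v) dμ`. -/
def energyForm {Ω : Type*} [MeasurableSpace Ω] (μ : Measure Ω)
    (Γ : (Ω → ℝ) → (Ω → ℝ) → Ω → ℝ) (u v : Ω → ℝ) : ℝ :=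
  (1 / 2) * ∫ z, Γ u v z ∂μ

/-! ### The SABR forms on `S = ℝ × (0,∞)` -/

/-- The measure `m_j(x,y) dx dy`, with `m_j = 1 / (√(1-ρ²) |x|^{β(1+j)} y²)`, on `ℝ × (0,∞)`. -/
def sabrMeasure (ρ β : ℝ) (j : ℕ) : Measure (ℝ × ℝ) :=
  (volume.restrict (Set.univ ×ˢ Set.Ioi (0 : ℝ))).withDensity fun z =>
    ENNReal.ofReal (1 / (Real.sqrt (1 - ρ ^ 2) * |z.1| ^ (β * (1 + j)) * z.2 ^ 2))

/-- `y² (|x|^{2β} ξₓηₓ + ρ |x|^β (ξₓη_y + ξ_yηₓ) + ξ_yη_y)` for covectors `ξ`, `η` at `(x,y)`. -/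
def sabrSymbol (ρ β : ℝ) (z : ℝ × ℝ) (ξ η : ℝ × ℝ →L[ℝ] ℝ) : ℝ :=
  z.2 ^ 2 * (|z.1| ^ (2 * β) * (ξ (1, 0) * η (1, 0)) +
    ρ * |z.1| ^ β * (ξ (1, 0) * η (0, 1) + ξ (0, 1) * η (1, 0)) + ξ (0, 1) * η (0, 1))

def sabrGamma (ρ β : ℝ) (u v : ℝ × ℝ → ℝ) (z : ℝ × ℝ) : ℝ :=
  sabrSymbol ρ β z (acDifferential (Set.Ioi 0) u z) (acDifferential (Set.Ioi 0) v z)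

def sabrDomain (ρ β : ℝ) (j : ℕ) : Set (ℝ × ℝ → ℝ) :=
  {u | MemLp u 2 (sabrMeasure ρ β j) ∧ (∃ G, HasACGradient (Set.Ioi 0) u G) ∧
    Integrable (sabrGamma ρ β u u) (sabrMeasure ρ β j)}

/-- The SABR metric
`(1-ρ²)⁻¹ (dx² / (y²|x|^{2β}) - 2ρ dx dy / (y²|x|^β) + dy² / y²)`. -/
def sabrMetric (ρ β : ℝ) (z v w : ℝ × ℝ) : ℝ :=
  1 / (1 - ρ ^ 2) * (v.1 * w.1 / (z.2 ^ 2 * |z.1| ^ (2 * β)) -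
    ρ * (v.1 * w.2 + v.2 * w.1) / (z.2 ^ 2 * |z.1| ^ β) + v.2 * w.2 / z.2 ^ 2)

/-! ### The time-changed SABR forms on `ℝ²` -/

/-- The measure `m̃_j(x,y) dx dy`, with `m̃_j = 1 / (√(1-ρ²) |x|^{β(1+j)})`, on `ℝ²`. -/
def tcMeasure (ρ β : ℝ) (j : ℕ) : Measure (ℝ × ℝ) :=
  (volume : Measure (ℝ × ℝ)).withDensity fun z =>
    ENNReal.ofReal (1 / (Real.sqrt (1 - ρ ^ 2) * |z.1| ^ (β * (1 + j))))

/-- `|x|^{2β} ξₓηₓ + ρ |x|^β (ξₓη_y + ξ_yηₓ) + ξ_yη_y` for covectors `ξ`, `η` at `(x,y)`. -/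
def tcSymbol (ρ β : ℝ) (z : ℝ × ℝ) (ξ η : ℝ × ℝ →L[ℝ] ℝ) : ℝ :=
  |z.1| ^ (2 * β) * (ξ (1, 0) * η (1, 0)) +
    ρ * |z.1| ^ β * (ξ (1, 0) * η (0, 1) + ξ (0, 1) * η (1, 0)) + ξ (0, 1) * η (0, 1)

def tcGamma (ρ β : ℝ) (u v : ℝ × ℝ → ℝ) (z : ℝ × ℝ) : ℝ :=
  tcSymbol ρ β z (acDifferential Set.univ u z) (acDifferential Set.univ v z)

def tcDomain (ρ β : ℝ) (j : ℕ) : Set (ℝ × ℝ → ℝ) :=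
  {u | MemLp u 2 (tcMeasure ρ β j) ∧ (∃ G, HasACGradient Set.univ u G) ∧
    Integrable (tcGamma ρ β u u) (tcMeasure ρ β j)}

/-- The metric `(1-ρ²)⁻¹ (dx² / |x|^{2β} - 2ρ dx dy / |x|^β + dy²)`. -/
def tcMetric (ρ β : ℝ) (z v w : ℝ × ℝ) : ℝ :=
  1 / (1 - ρ ^ 2) * (v.1 * w.1 / |z.1| ^ (2 * β) -
    ρ * (v.1 * w.2 + v.2 * w.1) / |z.1| ^ β + v.2 * w.2)

/-! ### The CEV form on `ℝ` -/

/-- The measure `|x|^{-2β} dx` on `ℝ`. -/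
def cevMeasure (β : ℝ) : Measure ℝ :=
  (volume : Measure ℝ).withDensity fun x => ENNReal.ofReal (1 / |x| ^ (2 * β))

/-- `σ² |x|^{2β} ξₓηₓ` for covectors `ξ`, `η` at `x`. -/
def cevSymbol (σ β : ℝ) (x : ℝ) (ξ η : ℝ →L[ℝ] ℝ) : ℝ :=
  σ ^ 2 * |x| ^ (2 * β) * (ξ 1 * η 1)

def cevGamma (σ β : ℝ) (u v : ℝ → ℝ) (x : ℝ) : ℝ :=
  cevSymbol σ β x (acDifferentialLine u x) (acDifferentialLine v x)

def cevDomain (σ β : ℝ) : Set (ℝ → ℝ) :=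
  {u | MemLp u 2 (cevMeasure β) ∧ (∃ g, Measurable g ∧ HasACDerivOn Set.univ u g) ∧
    Integrable (cevGamma σ β u u) (cevMeasure β)}

/-- The CEV metric `dx² / (σ² |x|^{2β})`. -/
def cevMetric (σ β : ℝ) (x v w : ℝ) : ℝ :=
  v * w / (σ ^ 2 * |x| ^ (2 * β))

/-! ### Comparison with the Riemannian gradient -/

/-- `g` is a Riemannian metric on `U`, and on `U` the density `Γ(u,v)`, built from the symbol `q`
and the differentials of `u` and `v`, is the `g`-inner product of the Riemannian gradients of `u`
and `v` (so `Γ(u,u)` is the squared length of the gradient of `u`): at every point for classically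
differentiable functions, and `μ`-almost everywhere, with the differential `d`, on `D`. -/
structure IsGradientInnerProductOn {E : Type*} [NormedAddCommGroup E] [NormedSpace ℝ E]
    [MeasurableSpace E] (U : Set E) (g : E → E → E → ℝ)
    (q : E → (E →L[ℝ] ℝ) → (E →L[ℝ] ℝ) → ℝ) (d : (E → ℝ) → E → E →L[ℝ] ℝ)
    (Γ : (E → ℝ) → (E → ℝ) → E → ℝ) (μ : Measure E) (D : Set (E → ℝ)) : Prop where
  isMetric : IsRiemannianMetricOn U g
  classical : ∀ z ∈ U, ∀ u v : E → ℝ, DifferentiableAt ℝ u z → DifferentiableAt ℝ v z →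
    ∃ X Y : E, IsRiemannianGradient g z (fderiv ℝ u z) X ∧
      IsRiemannianGradient g z (fderiv ℝ v z) Y ∧
      q z (fderiv ℝ u z) (fderiv ℝ v z) = g z X Y
  onDomain : ∀ u ∈ D, ∀ v ∈ D, ∀ᵐ z ∂μ, z ∈ U →
    ∃ X Y : E, IsRiemannianGradient g z (d u z) X ∧ IsRiemannianGradient g z (d v z) Y ∧
      Γ u v z = g z X Y

end

noncomputable section

/-! ### Absolutely continuous versions on an interval -/

section Interval

variable {I : Set ℝ} {f f₁ f₂ g g₁ g₂ : ℝ → ℝ}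

/-! All three forms are Dirichlet integrals `½ ∫ ⟨F_u, F_v⟩ dm`, where `F_u` is the gradient of `u`
in an orthonormal frame of the metric. Part (a) uses only the properties of `u ↦ F_u` listed in
`IsClosedDerivation`. The Leibniz rule gives the carré du champ identity. The chain rule for
truncations gives the Markov property and the density of bounded functions in the energy norm.
Closedness gives completeness. Separation gives density in `L²` and uniqueness of the operator on
bounded functions; truncation and continuity extend uniqueness to the whole domain. This is
`IsDirichletIntegral.hasEnergyMeasure`.

The analytic point is closedness, because the coefficients and the weight degenerate or blow up at
`x = 0`. If functions and gradients converge in `L²(m)` with summable errors, Tonelli's theorem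
gives convergence along almost every coordinate line. A weighted `L²` bound on the derivatives
becomes an `L¹_loc` bound by Cauchy–Schwarz if the inverse weight is locally integrable, and
`L¹_loc` convergence of derivatives preserves absolute continuity (`HasACDerivOn.of_tendsto`). With
`γ = β(1+j)`, the energy controls `∂ₓ` with weight `|x|^{2β-γ}`, whose inverse is locally integrable
across the axis because `γ - 2β > -1`. Vertical lines have constant positive weight when `x ≠ 0`.
For CEV the powers of `|x|` cancel.

Separation is tested with smooth functions supported away from the axis, a null set. These need only
be rich enough in `L²`; their density in the energy norm is never needed.

Part (b) is pointwise linear algebra: the symbol of `G` is the inverse matrix of the metric, so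
raising an index turns one into the other. -/

theorem HasACDerivOn.congr (h : HasACDerivOn I f₁ g₁) (hf : f₁ =ᵐ[volume.restrict I] f₂)
    (hg : g₁ =ᵐ[volume.restrict I] g₂) : HasACDerivOn I f₂ g₂ := by
  obtain ⟨v, hv, hfv, hd⟩ := h
  refine ⟨v, hv, hf.symm.trans hfv, ?_⟩
  filter_upwards [hd, hg] with s hs hgs
  exact hgs ▸ hs

theorem HasACDerivOn.add (h₁ : HasACDerivOn I f₁ g₁) (h₂ : HasACDerivOn I f₂ g₂) :
    HasACDerivOn I (fun s => f₁ s + f₂ s) (fun s => g₁ s + g₂ s) := by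
  obtain ⟨v, hv, hfv, hd⟩ := h₁
  obtain ⟨w, hw, hfw, hd'⟩ := h₂
  refine ⟨v + w, fun a ha b hb => (hv a ha b hb).add (hw a ha b hb), hfv.add hfw, ?_⟩
  filter_upwards [hd, hd'] with s hs hs'
  exact hs.add hs'

theorem HasACDerivOn.const_mul (c : ℝ) (h : HasACDerivOn I f g) :
    HasACDerivOn I (fun s => c * f s) (fun s => c * g s) := by
  obtain ⟨v, hv, hfv, hd⟩ := h
  refine ⟨fun s => c * v s, fun a ha b hb => (hv a ha b hb).const_mul c, ?_, ?_⟩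
  · filter_upwards [hfv] with s hs
    rw [hs]
  · filter_upwards [hd] with s hs
    exact hs.const_mul c

theorem HasACDerivOn.mul (h₁ : HasACDerivOn I f₁ g₁) (h₂ : HasACDerivOn I f₂ g₂) :
    HasACDerivOn I (fun s => f₁ s * f₂ s) (fun s => f₁ s * g₂ s + f₂ s * g₁ s) := by
  obtain ⟨v, hv, hfv, hd⟩ := h₁
  obtain ⟨w, hw, hfw, hd'⟩ := h₂
  refine ⟨v * w, fun a ha b hb => (hv a ha b hb).mul (hw a ha b hb), hfv.mul hfw, ?_⟩
  filter_upwards [hd, hd', hfv, hfw] with s hs hs' h1 h2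
  rw [h1, h2]
  convert! hs.mul hs' using 1
  ring

/-! ### Truncation of absolutely continuous functions -/

theorem lipschitzWith_clip (a b : ℝ) : LipschitzWith 1 (fun s : ℝ => min (max s a) b) :=
  (LipschitzWith.id.max_const a).min_const b

/-- Inside the open band the truncation is locally the identity. Elsewhere the truncated function
takes its least or greatest possible value at `s`, so its derivative, assumed to exist, vanishes. No
study of level sets is needed. -/
theorem HasDerivAt.clip {v : ℝ → ℝ} {a b d d' s : ℝ} (hab : a ≤ b) (hv : HasDerivAt v d s)
    (hc : HasDerivAt (fun s => min (max (v s) a) b) d' s) :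
    d' = if a < v s ∧ v s < b then d else 0 := by
  split_ifs with h
  · refine hc.unique (hv.congr_of_eventuallyEq ?_)
    filter_upwards [hv.continuousAt.eventually (lt_mem_nhds h.1),
      hv.continuousAt.eventually (gt_mem_nhds h.2)] with t h1 h2
    rw [max_eq_left h1.le, min_eq_left h2.le]
  · refine IsLocalExtr.hasDerivAt_eq_zero ?_ hc
    rw [not_and_or, not_lt, not_lt] at h
    rcases h with h | h
    · refine Or.inl (Eventually.of_forall fun t => ?_)
      simp only [max_eq_right h, min_eq_left hab]
      exact le_min (le_max_right _ _) hab
    · refine Or.inr (Eventually.of_forall fun t => ?_)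
      simp only [min_eq_right (h.trans (le_max_left (v s) a))]
      exact min_le_right _ _

theorem LipschitzWith.comp_absolutelyContinuousOnInterval {T v : ℝ → ℝ} {a b : ℝ}
    (hT : LipschitzWith 1 T) (hv : AbsolutelyContinuousOnInterval v a b) :
    AbsolutelyContinuousOnInterval (fun s => T (v s)) a b := by
  rw [absolutelyContinuousOnInterval_iff] at hv ⊢
  intro ε hε
  obtain ⟨δ, hδ, h⟩ := hv ε hε
  refine ⟨δ, hδ, fun E hE hEδ => lt_of_le_of_lt (Finset.sum_le_sum fun i _ => ?_) (h E hE hEδ)⟩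
  simpa using hT.dist_le_mul (v (E.2 i).1) (v (E.2 i).2)

theorem IsOpen.exists_Icc_mem_nhds (hI : IsOpen I) {x : ℝ} (hx : x ∈ I) :
    ∃ a ∈ I, ∃ b ∈ I, a ≤ b ∧ Set.Icc a b ∈ 𝓝 x := by
  obtain ⟨ε, hε, hb⟩ := Metric.isOpen_iff.1 hI x hx
  refine ⟨x - ε / 2, hb ?_, x + ε / 2, hb ?_, by linarith, Icc_mem_nhds (by linarith) (by linarith)⟩
  · rw [Metric.mem_ball, Real.dist_eq, abs_lt]; constructor <;> linarith
  · rw [Metric.mem_ball, Real.dist_eq, abs_lt]; constructor <;> linarith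

theorem IsOpen.ae_restrict_of_Icc (hI : IsOpen I) {p : ℝ → Prop}
    (h : ∀ a ∈ I, ∀ b ∈ I, ∀ᵐ s, s ∈ Set.uIcc a b → p s) : ∀ᵐ s ∂volume.restrict I, p s := by
  rw [ae_restrict_iff' hI.measurableSet, ae_iff]
  refine measure_null_of_locally_null _ fun x hx => ?_
  simp only [Classical.not_imp, Set.mem_ofPred_eq] at hx
  obtain ⟨a, ha, b, hb, hab, hnhds⟩ := hI.exists_Icc_mem_nhds hx.1
  refine ⟨_, inter_mem_nhdsWithin _ hnhds, measure_mono_null ?_ (ae_iff.1 (h a ha b hb))⟩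
  rintro s ⟨hs, hs'⟩
  simp only [Classical.not_imp, Set.mem_ofPred_eq] at hs ⊢
  exact ⟨Set.Icc_subset_uIcc hs', hs.2⟩

theorem HasACDerivOn.clip (hI : IsOpen I) {a b : ℝ} (hab : a ≤ b) (h : HasACDerivOn I f g) :
    HasACDerivOn I (fun s => min (max (f s) a) b)
      (fun s => if a < f s ∧ f s < b then g s else 0) := by
  obtain ⟨v, hv, hfv, hd⟩ := h
  have hac : ∀ c ∈ I, ∀ d ∈ I,
      AbsolutelyContinuousOnInterval (fun s => min (max (v s) a) b) c d := fun c hc d hd =>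
    (lipschitzWith_clip a b).comp_absolutelyContinuousOnInterval (hv c hc d hd)
  refine ⟨_, hac, ?_, ?_⟩
  · filter_upwards [hfv] with s hs
    rw [hs]
  · have hdiff : ∀ᵐ s ∂volume.restrict I,
        DifferentiableAt ℝ (fun s => min (max (v s) a) b) s :=
      hI.ae_restrict_of_Icc fun c hc d hd => (hac c hc d hd).ae_differentiableAt
    filter_upwards [hd, hdiff, hfv] with s hs hs' hfs
    have := hs.clip hab hs'.hasDerivAt
    rw [hfs, ← this]
    exact hs'.hasDerivAt

/-! ### Uniqueness and closedness of the derivative -/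

theorem continuousOn_of_forall_absolutelyContinuousOnInterval (hI : IsOpen I) {v : ℝ → ℝ}
    (hv : ∀ a ∈ I, ∀ b ∈ I, AbsolutelyContinuousOnInterval v a b) : ContinuousOn v I := by
  intro x hx
  obtain ⟨a, ha, b, hb, hab, hnhds⟩ := hI.exists_Icc_mem_nhds hx
  exact ((hv a ha b hb).continuousOn.continuousAt
    (mem_of_superset hnhds Set.Icc_subset_uIcc)).continuousWithinAt

/-- Two continuous versions that agree almost everywhere on an open set agree everywhere on it. -/
theorem HasACDerivOn.unique (hI : IsOpen I) (h₁ : HasACDerivOn I f g₁)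
    (h₂ : HasACDerivOn I f g₂) : g₁ =ᵐ[volume.restrict I] g₂ := by
  obtain ⟨v, hv, hfv, hd⟩ := h₁
  obtain ⟨w, hw, hfw, hd'⟩ := h₂
  have heq : Set.EqOn v w I := Measure.eqOn_open_of_ae_eq (hfv.symm.trans hfw) hI
    (continuousOn_of_forall_absolutelyContinuousOnInterval hI hv)
    (continuousOn_of_forall_absolutelyContinuousOnInterval hI hw)
  filter_upwards [hd, hd', ae_restrict_mem hI.measurableSet] with s hs hs' hsI
  exact hs.unique (hs'.congr_of_eventuallyEq (heq.eventuallyEq_of_mem (hI.mem_nhds hsI)))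

theorem ContDiff.hasACDerivOn (hf : ContDiff ℝ 1 f) : HasACDerivOn I f (deriv f) :=
  ⟨f, fun _ _ _ _ => hf.contDiffOn.absolutelyContinuousOnInterval, ae_eq_rfl,
    Eventually.of_forall fun s => (hf.differentiable one_ne_zero s).hasDerivAt⟩

/-- Locally absolutely continuous versions and `L¹_loc`-convergence of the derivatives. -/
theorem HasACDerivOn.of_tendsto (hI : IsOpen I) (hI' : I.OrdConnected) {F G : ℕ → ℝ → ℝ}
    (h : ∀ n, HasACDerivOn I (F n) (G n)) (hg : AEStronglyMeasurable g (volume.restrict I))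
    (hF : ∀ᵐ s ∂volume.restrict I, Tendsto (fun n => F n s) atTop (𝓝 (f s)))
    (hG : ∀ a ∈ I, ∀ b ∈ I,
      Tendsto (fun n => ∫⁻ s in Set.uIoc a b, ‖G n s - g s‖ₑ) atTop (𝓝 0)) :
    HasACDerivOn I f g := by
  rcases I.eq_empty_or_nonempty with rfl | hne
  · exact ⟨f, by simp, ae_eq_rfl, by simp⟩
  choose v hv hFv hd using h
  have hsub : ∀ a ∈ I, ∀ b ∈ I, Set.uIoc a b ⊆ I := fun a ha b hb =>
    Set.uIoc_subset_uIcc.trans (hI'.uIcc_subset ha hb)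
  have hFv' := ae_all_iff.2 hFv
  have : NeBot (ae (volume.restrict I)) := by
    rw [ae_neBot, Ne, Measure.restrict_eq_zero]
    exact (hI.measure_pos volume hne).ne'
  -- A base point at which every `F n` equals its version and the convergence holds; it fixes the
  -- constants of integration.
  obtain ⟨x₀, ⟨hx₀, hx₀'⟩, hx₀I⟩ :=
    ((hFv'.and hF).and (ae_restrict_mem hI.measurableSet)).exists
  have hdG : ∀ n, ∀ a ∈ I, ∀ b ∈ I,
      deriv (v n) =ᵐ[volume.restrict (Set.uIoc a b)] G n := fun n a ha b hb => by
    filter_upwards [ae_restrict_of_ae_restrict_of_subset (hsub a ha b hb) (hd n)] with s hs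
    exact hs.deriv
  have hGint : ∀ n, ∀ a ∈ I, ∀ b ∈ I, IntervalIntegrable (G n) volume a b :=
    fun n a ha b hb => (hv n a ha b hb).intervalIntegrable_deriv.congr_ae (hdG n a ha b hb)
  have hFTC : ∀ n, ∀ a ∈ I, ∀ b ∈ I, ∫ s in a..b, G n s = v n b - v n a :=
    fun n a ha b hb => by
      rw [← (hv n a ha b hb).integral_deriv_eq_sub]
      refine intervalIntegral.integral_congr_ae ?_
      filter_upwards [(ae_restrict_iff' measurableSet_uIoc).1 (hdG n a ha b hb)] with s hs h'
      exact (hs h').symm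
  have hgint : ∀ a ∈ I, ∀ b ∈ I, IntervalIntegrable g volume a b := fun a ha b hb => by
    -- A single `n` with finite `L¹` distance suffices: `g` inherits integrability from `G n`.
    obtain ⟨n, hn⟩ := ((hG a ha b hb).eventually (gt_mem_nhds ENNReal.zero_lt_top)).exists
    have h1 := intervalIntegrable_iff.1 (hGint n a ha b hb)
    have h2 : IntegrableOn (fun s => G n s - g s) (Set.uIoc a b) volume :=
      ⟨h1.aestronglyMeasurable.sub (hg.mono_set (hsub a ha b hb)), hn⟩
    rw [intervalIntegrable_iff]
    exact (h1.sub h2).congr (Eventually.of_forall fun s => by simp)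
  have hlim : ∀ x ∈ I, Tendsto (fun n => v n x) atTop (𝓝 (f x₀ + ∫ s in x₀..x, g s)) := by
    intro x hx
    have h1 : Tendsto (fun n => ∫ s in x₀..x, G n s) atTop (𝓝 (∫ s in x₀..x, g s)) := by
      rw [tendsto_iff_norm_sub_tendsto_zero]
      have h3 : Tendsto (fun n => (∫⁻ s in Set.uIoc x₀ x, ‖G n s - g s‖ₑ).toReal) atTop (𝓝 0) := by
        rw [← ENNReal.toReal_zero]
        exact (ENNReal.tendsto_toReal ENNReal.zero_ne_top).comp (hG x₀ hx₀I x hx)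
      refine squeeze_zero (fun _ => norm_nonneg _) (fun n => ?_) h3
      rw [← intervalIntegral.integral_sub (hGint n _ hx₀I _ hx) (hgint _ hx₀I _ hx)]
      refine intervalIntegral.norm_integral_le_integral_norm_uIoc.trans ?_
      rw [integral_norm_eq_lintegral_enorm]
      exact (intervalIntegrable_iff.1
        ((hGint n _ hx₀I _ hx).sub (hgint _ hx₀I _ hx))).aestronglyMeasurable
    refine (hx₀'.add h1).congr fun n => ?_
    rw [hFTC n x₀ hx₀I x hx, hx₀ n]
    ring
  refine ⟨fun x => f x₀ + ∫ s in x₀..x, g s, fun a ha b hb => ?_, ?_, ?_⟩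
  -- A primitive based at `x₀` is known to be absolutely continuous on intervals containing `x₀`, so
  -- `[a, b]` is first enlarged to contain it.
  · have hmin : min (min a b) x₀ ∈ I := by
      rcases min_choice (min a b) x₀ with h | h <;> rw [h]
      · rcases min_choice a b with h | h <;> rw [h] <;> assumption
      · assumption
    have hmax : max (max a b) x₀ ∈ I := by
      rcases max_choice (max a b) x₀ with h | h <;> rw [h]
      · rcases max_choice a b with h | h <;> rw [h] <;> assumption
      · assumption
    have hsub' : ∀ t, min (min a b) x₀ ≤ t → t ≤ max (max a b) x₀ →
        t ∈ Set.uIcc (min (min a b) x₀) (max (max a b) x₀) := fun t h1 h2 =>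
      Set.Icc_subset_uIcc ⟨h1, h2⟩
    have h1 := (hgint _ hmin _ hmax).absolutelyContinuousOnInterval_intervalIntegral
      (hsub' x₀ (min_le_right _ _) (le_max_right _ _))
    have h2 : AbsolutelyContinuousOnInterval (fun _ : ℝ => f x₀) (min (min a b) x₀)
      (max (max a b) x₀) := contDiffOn_const.absolutelyContinuousOnInterval
    refine (h2.add h1).mono (Set.uIcc_subset_uIcc (hsub' _ ?_ ?_) (hsub' _ ?_ ?_)) <;> simp
  · filter_upwards [hFv', hF, ae_restrict_mem hI.measurableSet] with s hs hs' hsI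
    exact tendsto_nhds_unique hs' ((hlim s hsI).congr fun n => (hs n).symm)
  · refine hI.ae_restrict_of_Icc fun a ha b hb => ?_
    filter_upwards [(hgint a ha b hb).ae_hasDerivAt_integral] with x hx hx'
    have hxI := hI'.uIcc_subset ha hb hx'
    have h1 := (hx hx' a Set.left_mem_uIcc).const_add (f x₀ + ∫ s in x₀..a, g s)
    refine h1.congr_of_eventuallyEq ?_
    filter_upwards [hI.mem_nhds hxI] with t ht
    rw [add_assoc, intervalIntegral.integral_add_adjacent_intervals (hgint _ hx₀I _ ha)
      (hgint _ ha _ ht)]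

/-- A version of `HasACDerivOn.of_tendsto` with derivatives converging in a weighted `L²`-space. -/
theorem HasACDerivOn.of_tendsto_sq (hI : IsOpen I) (hI' : I.OrdConnected) {F G : ℕ → ℝ → ℝ}
    (h : ∀ n, HasACDerivOn I (F n) (G n)) (hG : ∀ n, AEMeasurable (G n) (volume.restrict I))
    (hg : AEMeasurable g (volume.restrict I)) {κ : ℝ → ℝ} (hκ : Measurable κ)
    (hκ₀ : ∀ᵐ s ∂volume.restrict I, 0 < κ s)
    (hκ' : ∀ a ∈ I, ∀ b ∈ I, IntervalIntegrable (fun s => (κ s)⁻¹) volume a b)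
    (hF : ∀ᵐ s ∂volume.restrict I, Tendsto (fun n => F n s) atTop (𝓝 (f s)))
    (hL : Tendsto (fun n => ∫⁻ s in I, ENNReal.ofReal (κ s) * ‖G n s - g s‖ₑ ^ 2) atTop (𝓝 0)) :
    HasACDerivOn I f g := by
  refine HasACDerivOn.of_tendsto hI hI' h hg.aestronglyMeasurable hF fun a ha b hb => ?_
  have hsub : Set.uIoc a b ⊆ I := Set.uIoc_subset_uIcc.trans (hI'.uIcc_subset ha hb)
  set C := ∫⁻ s in Set.uIoc a b, ENNReal.ofReal (κ s)⁻¹ with hC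
  have hCtop : C ≠ ⊤ := (intervalIntegrable_iff.1 (hκ' a ha b hb)).lintegral_lt_top.ne
  have hlim : Tendsto (fun n => (∫⁻ s in I, ENNReal.ofReal (κ s) * ‖G n s - g s‖ₑ ^ 2) ^
      (1 / 2 : ℝ) * C ^ (1 / 2 : ℝ)) atTop (𝓝 0) := by
    have h1 := (ENNReal.continuous_rpow_const (y := (1 / 2 : ℝ))).tendsto _ |>.comp hL
    rw [ENNReal.zero_rpow_of_pos (by norm_num)] at h1
    simpa using ENNReal.Tendsto.mul_const h1 (b := C ^ (1 / 2 : ℝ))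
      (Or.inr (ENNReal.rpow_ne_top_of_nonneg (by norm_num) hCtop))
  refine tendsto_of_tendsto_of_tendsto_of_le_of_le tendsto_const_nhds hlim (fun _ => zero_le)
    fun n => ?_
  have hm : AEMeasurable (fun s => ENNReal.ofReal (κ s) * ‖G n s - g s‖ₑ ^ 2)
      (volume.restrict (Set.uIoc a b)) :=
    (hκ.ennreal_ofReal.aemeasurable.mul (((hG n).sub hg).enorm.pow_const 2)).mono_set hsub
  -- Cauchy–Schwarz for the factorization `|h| = (κ h²)^{1/2} (κ⁻¹)^{1/2}`.
  calc ∫⁻ s in Set.uIoc a b, ‖G n s - g s‖ₑ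
      = ∫⁻ s in Set.uIoc a b, (ENNReal.ofReal (κ s) * ‖G n s - g s‖ₑ ^ 2) ^ (1 / 2 : ℝ) *
          ENNReal.ofReal (κ s)⁻¹ ^ (1 / 2 : ℝ) := by
        refine lintegral_congr_ae ?_
        filter_upwards [ae_restrict_of_ae_restrict_of_subset hsub hκ₀] with s hs
        rw [← ENNReal.mul_rpow_of_nonneg _ _ (by norm_num), mul_right_comm,
          ← ENNReal.ofReal_mul hs.le, mul_inv_cancel₀ hs.ne', ENNReal.ofReal_one, one_mul,
          ← ENNReal.rpow_natCast, ← ENNReal.rpow_mul]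
        norm_num
    _ ≤ (∫⁻ s in Set.uIoc a b, ENNReal.ofReal (κ s) * ‖G n s - g s‖ₑ ^ 2) ^ (1 / 2 : ℝ) *
          C ^ (1 / 2 : ℝ) :=
        ENNReal.lintegral_mul_norm_pow_le hm hκ.inv.ennreal_ofReal.aemeasurable
          (by norm_num) (by norm_num) (by norm_num)
    _ ≤ _ := by
        gcongr

theorem intervalIntegrable_abs_rpow {r : ℝ} (hr : -1 < r) (a b : ℝ) :
    IntervalIntegrable (fun x : ℝ => |x| ^ r) volume a b := by
  have hpos : ∀ c : ℝ, 0 ≤ c → IntervalIntegrable (fun x : ℝ => |x| ^ r) volume 0 c :=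
    fun c hc => (intervalIntegral.intervalIntegrable_rpow' hr).congr fun x hx => by
      rw [Set.uIoc_of_le hc] at hx
      simp only [abs_of_pos hx.1]
  have h0 : ∀ c : ℝ, IntervalIntegrable (fun x : ℝ => |x| ^ r) volume 0 c := fun c => by
    rcases le_total 0 c with hc | hc
    · exact hpos c hc
    · rw [IntervalIntegrable.iff_comp_neg]
      simpa using hpos (-c) (by linarith)
  exact (h0 a).symm.trans (h0 b)

end Interval

/-! ### Almost everywhere convergence from summability -/

/-- The sum of the `f n` has finite integral, hence is finite almost everywhere, and the terms of a
convergent series tend to zero. Summability thus avoids passing to a further subsequence. -/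
theorem ae_tendsto_zero_of_tsum_lintegral_ne_top {α : Type*} [MeasurableSpace α] {μ : Measure α}
    {f : ℕ → α → ENNReal} (hf : ∀ n, AEMeasurable (f n) μ) (h : ∑' n, ∫⁻ x, f n x ∂μ ≠ ⊤) :
    ∀ᵐ x ∂μ, Tendsto (fun n => f n x) atTop (𝓝 0) := by
  rw [← lintegral_tsum hf] at h
  filter_upwards [ae_lt_top' (AEMeasurable.tsum hf) h] with x hx
  exact ENNReal.tendsto_atTop_zero_of_tsum_ne_top hx.ne

theorem ae_tendsto_of_tsum_lintegral_sq_ne_top {α : Type*} [MeasurableSpace α] {μ : Measure α}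
    {u : ℕ → α → ℝ} {w : α → ℝ} (hf : ∀ n, AEMeasurable (fun z => ‖u n z - w z‖ₑ ^ 2) μ)
    (h : ∑' n, ∫⁻ z, ‖u n z - w z‖ₑ ^ 2 ∂μ ≠ ⊤) :
    ∀ᵐ z ∂μ, Tendsto (fun n => u n z) atTop (𝓝 (w z)) := by
  filter_upwards [ae_tendsto_zero_of_tsum_lintegral_ne_top hf h] with z hz
  rw [tendsto_iff_edist_tendsto_0]
  have h1 := (ENNReal.continuous_rpow_const (y := (1 / 2 : ℝ))).tendsto _ |>.comp hz
  rw [ENNReal.zero_rpow_of_pos (by norm_num)] at h1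
  refine h1.congr fun n => ?_
  rw [Function.comp_apply, ← ENNReal.rpow_natCast, ← ENNReal.rpow_mul, edist_eq_enorm_sub]
  norm_num

/-- By Tonelli the integrals over the lines are again summable in mean, so one and the same sequence
works on almost every line. -/
theorem ae_tendsto_lintegral_section {α γ : Type*} [MeasurableSpace α] [MeasurableSpace γ]
    {μ : Measure α} {ν : Measure γ} [SFinite ν] {f : ℕ → α × γ → ENNReal}
    (hf : ∀ n, AEMeasurable (f n) (μ.prod ν)) (h : ∑' n, ∫⁻ z, f n z ∂μ.prod ν ≠ ⊤) :
    ∀ᵐ x ∂μ, Tendsto (fun n => ∫⁻ y, f n (x, y) ∂ν) atTop (𝓝 0) :=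
  ae_tendsto_zero_of_tsum_lintegral_ne_top (fun n => (hf n).lintegral_prod_right')
    (by simpa only [lintegral_prod _ (hf _)] using h)

theorem ae_tendsto_lintegral_section_symm {α γ : Type*} [MeasurableSpace α] [MeasurableSpace γ]
    {μ : Measure α} {ν : Measure γ} [SFinite μ] [SFinite ν] {f : ℕ → α × γ → ENNReal}
    (hf : ∀ n, AEMeasurable (f n) (μ.prod ν)) (h : ∑' n, ∫⁻ z, f n z ∂μ.prod ν ≠ ⊤) :
    ∀ᵐ y ∂ν, Tendsto (fun n => ∫⁻ x, f n (x, y) ∂μ) atTop (𝓝 0) :=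
  ae_tendsto_zero_of_tsum_lintegral_ne_top
    (fun n => (hf n).prod_swap.lintegral_prod_right')
    (by simpa only [lintegral_prod_symm _ (hf _)] using h)

theorem ae_ae_of_ae_prod_symm {α γ : Type*} [MeasurableSpace α] [MeasurableSpace γ]
    {μ : Measure α} {ν : Measure γ} [SFinite μ] [SFinite ν] {p : α × γ → Prop}
    (h : ∀ᵐ z ∂μ.prod ν, p z) : ∀ᵐ y ∂ν, ∀ᵐ x ∂μ, p (x, y) := by
  rw [← Measure.prod_swap] at h
  exact Measure.ae_ae_of_ae_prod (ae_of_ae_map measurable_swap.aemeasurable h)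

/-! ### Square integrable functions with values in a Hilbert space -/

section SquareIntegrable

variable {Ω : Type*} [MeasurableSpace Ω] {μ : Measure Ω}
  {V : Type*} [NormedAddCommGroup V] [InnerProductSpace ℝ V]

theorem MeasureTheory.MemLp.norm_toLp_sq {F : Ω → V} (hF : MemLp F 2 μ) :
    ‖hF.toLp F‖ ^ 2 = ∫ z, ‖F z‖ ^ 2 ∂μ := by
  rw [← real_inner_self_eq_norm_sq, L2.inner_def]
  refine integral_congr_ae ?_
  filter_upwards [hF.coeFn_toLp] with z hz
  rw [hz, real_inner_self_eq_norm_sq]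

theorem MeasureTheory.MemLp.lintegral_enorm_sq {W : Type*} [NormedAddCommGroup W] {F : Ω → W}
    (hF : MemLp F 2 μ) :
    ∫⁻ z, ‖F z‖ₑ ^ 2 ∂μ = ENNReal.ofReal (∫ z, ‖F z‖ ^ 2 ∂μ) := by
  rw [ofReal_integral_eq_lintegral_ofReal (hF.integrable_norm_pow two_ne_zero)
    (Eventually.of_forall fun z => by positivity)]
  refine lintegral_congr fun z => ?_
  rw [ENNReal.ofReal_pow (norm_nonneg _), ofReal_norm]

theorem MeasureTheory.MemLp.integrable_real_inner {F G : Ω → V} (hF : MemLp F 2 μ)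
    (hG : MemLp G 2 μ) : Integrable (fun z => inner ℝ (F z) (G z)) μ := by
  refine (L2.integrable_inner (𝕜 := ℝ) (hF.toLp F) (hG.toLp G)).congr ?_
  filter_upwards [hF.coeFn_toLp, hG.coeFn_toLp] with z h1 h2
  rw [h1, h2]

theorem MeasureTheory.MemLp.integral_abs_inner_le {F G : Ω → V} (hF : MemLp F 2 μ)
    (hG : MemLp G 2 μ) :
    ∫ z, |inner ℝ (F z) (G z)| ∂μ ≤
      √(∫ z, ‖F z‖ ^ 2 ∂μ) * √(∫ z, ‖G z‖ ^ 2 ∂μ) := by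
  have h1 : ∫ z, ‖F z‖ * ‖G z‖ ∂μ ≤ √(∫ z, ‖F z‖ ^ 2 ∂μ) * √(∫ z, ‖G z‖ ^ 2 ∂μ) := by
    have h := real_inner_le_norm (hF.norm.toLp _) (hG.norm.toLp _)
    have hn : ∀ {F : Ω → V} (hF : MemLp F 2 μ),
        ‖hF.norm.toLp (fun z => ‖F z‖)‖ = √(∫ z, ‖F z‖ ^ 2 ∂μ) := fun hF => by
      rw [← Real.sqrt_sq (norm_nonneg _), hF.norm.norm_toLp_sq]
      simp
    rw [hn hF, hn hG, L2.inner_def] at h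
    refine le_of_eq_of_le (integral_congr_ae ?_) h
    filter_upwards [hF.norm.coeFn_toLp, hG.norm.coeFn_toLp] with z h1 h2
    rw [h1, h2]
    simp [mul_comm]
  refine (integral_mono (hF.integrable_real_inner hG).abs ?_ fun z => ?_).trans h1
  · exact hF.norm.integrable_mul hG.norm
  · exact abs_real_inner_le_norm _ _

theorem MeasureTheory.MemLp.clip {a b : ℝ} (ha : a ≤ 0) (hb : 0 ≤ b) {u : Ω → ℝ}
    (hu : MemLp u 2 μ) :
    MemLp (fun z => min (max (u z) a) b) 2 μ := by
  refine hu.mono ((lipschitzWith_clip a b).continuous.comp_aestronglyMeasurable hu.1)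
    (Eventually.of_forall fun z => ?_)
  have := (lipschitzWith_clip a b).dist_le_mul (u z) 0
  simpa [ha, hb] using this

theorem MeasureTheory.MemLp.clip_top {a b : ℝ} (hab : a ≤ b) {u : Ω → ℝ} (hu : MemLp u 2 μ) :
    MemLp (fun z => min (max (u z) a) b) ⊤ μ := by
  refine memLp_top_of_bound
    ((lipschitzWith_clip a b).continuous.comp_aestronglyMeasurable hu.1) (max |a| |b|)
    (Eventually.of_forall fun z => ?_)
  rw [Real.norm_eq_abs]
  exact abs_le_max_abs_abs (le_min (le_max_right _ _) hab) (min_le_right _ _)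

theorem clip_gradient_norm_le {Ω V : Type*} [NormedAddCommGroup V] {a b : ℝ} {u : Ω → ℝ}
    {F : Ω → V} (z : Ω) :
    ‖(if a < u z ∧ u z < b then F z else 0)‖ ≤ ‖F z‖ := by
  split_ifs <;> simp

theorem MeasureTheory.Integrable.mul_of_memLp_top {f g : Ω → ℝ} (hg : Integrable g μ)
    (hf : MemLp f ⊤ μ) :
    Integrable (fun z => f z * g z) μ :=
  memLp_one_iff_integrable.1 ((memLp_one_iff_integrable.2 hg).smul hf)

end SquareIntegrable

/-! ### Closed derivations -/

/-- `P u F` says that `F` is the gradient of `u` in an orthonormal frame. The gradient is a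
derivation that obeys the chain rule for truncations and is closed in `L²(μ)`, and the bounded
square integrable functions with square integrable gradient separate functions. -/
structure IsClosedDerivation {Ω : Type*} [MeasurableSpace Ω] (μ : Measure Ω) {V : Type*}
    [NormedAddCommGroup V] [InnerProductSpace ℝ V] (P : (Ω → ℝ) → (Ω → V) → Prop) : Prop where
  aestronglyMeasurable : ∀ {u F}, P u F → AEStronglyMeasurable F μ
  congr : ∀ {u v F G}, P u F → u =ᵐ[μ] v → F =ᵐ[μ] G → P v G
  unique : ∀ {u F G}, P u F → P u G → F =ᵐ[μ] G
  zero : P 0 0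
  add : ∀ {u v F G}, P u F → P v G → P (u + v) (F + G)
  smul : ∀ (c : ℝ) {u F}, P u F → P (c • u) (c • F)
  mul : ∀ {u v F G}, AEStronglyMeasurable u μ → AEStronglyMeasurable v μ → P u F → P v G →
    P (u * v) (fun z => u z • G z + v z • F z)
  clip : ∀ {a b : ℝ} {u F}, a ≤ b → AEStronglyMeasurable u μ → P u F →
    P (fun z => min (max (u z) a) b) (fun z => if a < u z ∧ u z < b then F z else 0)
  closed : ∀ {u : ℕ → Ω → ℝ} {F : ℕ → Ω → V} {w : Ω → ℝ} {W : Ω → V},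
    (∀ n, AEStronglyMeasurable (u n) μ) → (∀ n, P (u n) (F n)) →
    AEStronglyMeasurable w μ → AEStronglyMeasurable W μ →
    ∑' n, ∫⁻ z, ‖u n z - w z‖ₑ ^ 2 + ‖F n z - W z‖ₑ ^ 2 ∂μ ≠ ⊤ → P w W
  separating : ∀ {f : Ω → ℝ}, AEStronglyMeasurable f μ →
    (∀ h H, P h H → MemLp h 2 μ → MemLp h ⊤ μ → MemLp H 2 μ →
      Integrable (h * f) μ ∧ ∫ z, h z * f z ∂μ = 0) → f =ᵐ[μ] 0

section Derivation

variable {Ω : Type*} [MeasurableSpace Ω] {μ : Measure Ω} {V : Type*}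
  [NormedAddCommGroup V] [InnerProductSpace ℝ V] {P : (Ω → ℝ) → (Ω → V) → Prop}
  {D : Set (Ω → ℝ)} {Γ : (Ω → ℝ) → (Ω → ℝ) → Ω → ℝ}

/-- `D` is the domain of the Dirichlet integral of the derivation `P`, and `Γ(u,v)` is the inner
product of the gradients. -/
structure IsDirichletIntegral (μ : Measure Ω) (P : (Ω → ℝ) → (Ω → V) → Prop) (D : Set (Ω → ℝ))
    (Γ : (Ω → ℝ) → (Ω → ℝ) → Ω → ℝ) : Prop where
  derivation : IsClosedDerivation μ P
  mem_iff : ∀ {u}, u ∈ D ↔ MemLp u 2 μ ∧ ∃ F, P u F ∧ MemLp F 2 μ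
  eq_inner : ∀ {u v F G}, P u F → P v G → Γ u v =ᵐ[μ] fun z => inner ℝ (F z) (G z)

namespace IsDirichletIntegral

theorem mem (h : IsDirichletIntegral μ P D Γ) {u : Ω → ℝ} {F : Ω → V} (hu : MemLp u 2 μ)
    (hF : P u F) (hF' : MemLp F 2 μ) : u ∈ D :=
  h.mem_iff.2 ⟨hu, F, hF, hF'⟩

theorem congr_mem (h : IsDirichletIntegral μ P D Γ) {u v : Ω → ℝ} (hu : u ∈ D) (huv : u =ᵐ[μ] v) :
    v ∈ D := by
  obtain ⟨hu2, F, hF, hF2⟩ := h.mem_iff.1 hu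
  exact h.mem (hu2.ae_eq huv) (h.derivation.congr hF huv ae_eq_rfl) hF2

theorem add_mem (h : IsDirichletIntegral μ P D Γ) {u v : Ω → ℝ} (hu : u ∈ D) (hv : v ∈ D) :
    u + v ∈ D := by
  obtain ⟨hu2, F, hF, hF2⟩ := h.mem_iff.1 hu
  obtain ⟨hv2, G, hG, hG2⟩ := h.mem_iff.1 hv
  exact h.mem (hu2.add hv2) (h.derivation.add hF hG) (hF2.add hG2)

theorem smul_mem (h : IsDirichletIntegral μ P D Γ) (c : ℝ) {u : Ω → ℝ} (hu : u ∈ D) :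
    c • u ∈ D := by
  obtain ⟨hu2, F, hF, hF2⟩ := h.mem_iff.1 hu
  exact h.mem (hu2.const_smul c) (h.derivation.smul c hF) (hF2.const_smul c)

theorem sub_gradient (h : IsDirichletIntegral μ P D Γ) {u v : Ω → ℝ} {F G : Ω → V} (hF : P u F)
    (hG : P v G) :
    P (u - v) (F - G) := by
  have := h.derivation.add hF (h.derivation.smul (-1) hG)
  simpa [sub_eq_add_neg] using this

theorem zero_mem (h : IsDirichletIntegral μ P D Γ) :
    (0 : Ω → ℝ) ∈ D := h.mem MemLp.zero h.derivation.zero MemLp.zero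

theorem memLp_mul_gradient {f g : Ω → ℝ} {F G : Ω → V} (hf : MemLp f ⊤ μ) (hg : MemLp g ⊤ μ)
    (hF : MemLp F 2 μ) (hG : MemLp G 2 μ) : MemLp (fun z => f z • G z + g z • F z) 2 μ :=
  (hG.smul hf).add (hF.smul hg)

theorem mul_gradient (h : IsDirichletIntegral μ P D Γ) {f g : Ω → ℝ} {F G : Ω → V}
    (hf : MemLp f ⊤ μ) (hg : MemLp g ⊤ μ)
    (hF : P f F) (hG : P g G) : P (f * g) (fun z => f z • G z + g z • F z) :=
  h.derivation.mul hf.1 hg.1 hF hG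

theorem integrable_gamma (h : IsDirichletIntegral μ P D Γ) {u v : Ω → ℝ} (hu : u ∈ D) (hv : v ∈ D) :
    Integrable (Γ u v) μ := by
  obtain ⟨hu2, F, hF, hF2⟩ := h.mem_iff.1 hu
  obtain ⟨hv2, G, hG, hG2⟩ := h.mem_iff.1 hv
  exact (hF2.integrable_real_inner hG2).congr (h.eq_inner hF hG).symm

theorem energyForm_eq (h : IsDirichletIntegral μ P D Γ) {u v : Ω → ℝ} {F G : Ω → V} (hF : P u F)
    (hG : P v G) :
    energyForm μ Γ u v = 1 / 2 * ∫ z, inner ℝ (F z) (G z) ∂μ := by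
  rw [energyForm, integral_congr_ae (h.eq_inner hF hG)]

theorem energyForm_self (h : IsDirichletIntegral μ P D Γ) {u : Ω → ℝ} {F : Ω → V} (hF : P u F) :
    energyForm μ Γ u u = 1 / 2 * ∫ z, ‖F z‖ ^ 2 ∂μ := by
  simp only [h.energyForm_eq hF hF, real_inner_self_eq_norm_sq]

theorem energyNormSq_eq (h : IsDirichletIntegral μ P D Γ) {u : Ω → ℝ} {F : Ω → V} (hF : P u F) :
    energyNormSq μ (energyForm μ Γ) u = 1 / 2 * ∫ z, ‖F z‖ ^ 2 ∂μ + ∫ z, ‖u z‖ ^ 2 ∂μ := by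
  simp only [energyNormSq, h.energyForm_self hF, Real.norm_eq_abs, sq_abs]

theorem gamma_add_left (h : IsDirichletIntegral μ P D Γ) {u v w : Ω → ℝ} (hu : u ∈ D) (hv : v ∈ D)
    (hw : w ∈ D) :
    Γ (u + v) w =ᵐ[μ] Γ u w + Γ v w := by
  obtain ⟨-, F, hF, -⟩ := h.mem_iff.1 hu
  obtain ⟨-, G, hG, -⟩ := h.mem_iff.1 hv
  obtain ⟨-, H, hH, -⟩ := h.mem_iff.1 hw
  filter_upwards [h.eq_inner (h.derivation.add hF hG) hH, h.eq_inner hF hH, h.eq_inner hG hH]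
    with z h1 h2 h3
  simp only [h1, Pi.add_apply, h2, h3, inner_add_left]

theorem gamma_smul_left (h : IsDirichletIntegral μ P D Γ) (c : ℝ) {u v : Ω → ℝ} (hu : u ∈ D)
    (hv : v ∈ D) :
    Γ (c • u) v =ᵐ[μ] c • Γ u v := by
  obtain ⟨-, F, hF, -⟩ := h.mem_iff.1 hu
  obtain ⟨-, G, hG, -⟩ := h.mem_iff.1 hv
  filter_upwards [h.eq_inner (h.derivation.smul c hF) hG, h.eq_inner hF hG] with z h1 h2
  simp only [h1, Pi.smul_apply, h2, real_inner_smul_left, smul_eq_mul]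

theorem gamma_symm (h : IsDirichletIntegral μ P D Γ) {u v : Ω → ℝ} (hu : u ∈ D) (hv : v ∈ D) :
    Γ u v =ᵐ[μ] Γ v u := by
  obtain ⟨-, F, hF, -⟩ := h.mem_iff.1 hu
  obtain ⟨-, G, hG, -⟩ := h.mem_iff.1 hv
  filter_upwards [h.eq_inner hF hG, h.eq_inner hG hF] with z h1 h2
  rw [h1, h2, real_inner_comm]

theorem gamma_nonneg (h : IsDirichletIntegral μ P D Γ) {u : Ω → ℝ} (hu : u ∈ D) :
    0 ≤ᵐ[μ] Γ u u := by
  obtain ⟨-, F, hF, -⟩ := h.mem_iff.1 hu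
  filter_upwards [h.eq_inner hF hF] with z h1
  rw [h1]
  exact real_inner_self_nonneg

theorem clip_mem (h : IsDirichletIntegral μ P D Γ) {a b : ℝ} (ha : a ≤ 0) (hb : 0 ≤ b) {u : Ω → ℝ}
    (hu : u ∈ D) :
    (fun z => min (max (u z) a) b) ∈ D := by
  obtain ⟨hu2, F, hF, hF2⟩ := h.mem_iff.1 hu
  have hc := h.derivation.clip (ha.trans hb) hu2.1 hF
  exact h.mem (hu2.clip ha hb) hc (hF2.mono (h.derivation.aestronglyMeasurable hc)
    (Eventually.of_forall clip_gradient_norm_le))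

/-- The truncations of `u ∈ D` approximate `u` in the energy norm. -/
theorem tendsto_energyNormSq_clip (h : IsDirichletIntegral μ P D Γ) {u : Ω → ℝ} (hu : u ∈ D) :
    Tendsto (fun n : ℕ => energyNormSq μ (energyForm μ Γ)
      ((fun z => min (max (u z) (-n)) n) - u)) atTop (𝓝 0) := by
  obtain ⟨hu2, F, hF, hF2⟩ := h.mem_iff.1 hu
  have hn : ∀ n : ℕ, (-n : ℝ) ≤ 0 ∧ (0 : ℝ) ≤ n := fun n => by
    have : (0 : ℝ) ≤ n := n.cast_nonneg
    constructor <;> linarith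
  have hc : ∀ n : ℕ, P (fun z => min (max (u z) (-n)) n)
      (fun z => if -(n : ℝ) < u z ∧ u z < n then F z else 0) := fun n =>
    h.derivation.clip ((hn n).1.trans (hn n).2) hu2.1 hF
  have heq : ∀ n : ℕ, energyNormSq μ (energyForm μ Γ)
      ((fun z => min (max (u z) (-n)) n) - u) = _ := fun n =>
    h.energyNormSq_eq (h.sub_gradient (hc n) hF)
  simp only [heq]
  have hev : ∀ z, ∀ᶠ n : ℕ in atTop, -(n : ℝ) < u z ∧ u z < n := fun z => by
    filter_upwards [(tendsto_natCast_atTop_atTop (R := ℝ)).eventually_gt_atTop |u z|] with n hn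
    exact abs_lt.1 hn
  have h1 : Tendsto (fun n : ℕ => ∫ z, ‖((fun z => if -(n : ℝ) < u z ∧ u z < n then F z else 0) - F)
      z‖ ^ 2 ∂μ) atTop (𝓝 (∫ _, (0 : ℝ) ∂μ)) := by
    refine tendsto_integral_of_dominated_convergence (fun z => ‖F z‖ ^ 2)
      (fun n => ((h.derivation.aestronglyMeasurable (hc n)).sub hF2.1).norm.pow 2)
      (hF2.integrable_norm_pow two_ne_zero) (fun n => Eventually.of_forall fun z => ?_)
      (Eventually.of_forall fun z => ?_)
    · simp only [Pi.sub_apply, norm_pow, norm_norm]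
      gcongr
      split_ifs <;> simp
    · refine tendsto_const_nhds.congr' ?_
      filter_upwards [hev z] with n hn
      simp [hn]
  have h2 : Tendsto (fun n : ℕ => ∫ z, ‖((fun z => min (max (u z) (-n)) n) - u) z‖ ^ 2 ∂μ)
      atTop (𝓝 (∫ _, (0 : ℝ) ∂μ)) := by
    refine tendsto_integral_of_dominated_convergence (fun z => (2 * ‖u z‖) ^ 2)
      (fun n => ((hu2.clip (hn n).1 (hn n).2).1.sub hu2.1).norm.pow 2)
      ?_ (fun n => Eventually.of_forall fun z => ?_) (Eventually.of_forall fun z => ?_)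
    · simp only [mul_pow]
      exact (hu2.integrable_norm_pow two_ne_zero).const_mul _
    · simp only [Pi.sub_apply, norm_pow, norm_norm]
      gcongr
      refine (norm_sub_le _ _).trans ?_
      have := (lipschitzWith_clip (-n) n).dist_le_mul (u z) 0
      simp only [(hn n).1, (hn n).2, max_eq_left, min_eq_left, dist_zero_right, NNReal.coe_one,
        one_mul] at this
      linarith
    · refine tendsto_const_nhds.congr' ?_
      filter_upwards [hev z] with n hn
      simp [max_eq_left hn.1.le, min_eq_left hn.2.le]
  rw [show (0 : ℝ) = 1 / 2 * ∫ _, (0 : ℝ) ∂μ + ∫ _, (0 : ℝ) ∂μ by simp]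
  exact (h1.const_mul (1 / 2)).add h2

/-! ### Density in `L²`, completeness and the Markov property -/

theorem dense (h : IsDirichletIntegral μ P D Γ) [CompleteSpace V] {u : Ω → ℝ} (hu : MemLp u 2 μ)
    {ε : ℝ} (hε : 0 < ε) :
    ∃ v ∈ D, ∫ z, (u z - v z) ^ 2 ∂μ < ε := by
  let K : Submodule ℝ (Lp ℝ 2 μ) :=
    { carrier := {f | ⇑f ∈ D}
      add_mem' := fun {f g} hf hg => h.congr_mem (h.add_mem hf hg) (Lp.coeFn_add f g).symm
      zero_mem' := h.congr_mem h.zero_mem (Lp.coeFn_zero ℝ 2 μ).symm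
      smul_mem' := fun c f hf => h.congr_mem (h.smul_mem c hf) (Lp.coeFn_smul c f).symm }
  -- A function orthogonal to the domain is orthogonal to its bounded elements, hence zero by
  -- `separating`.
  have hK : Kᗮ = ⊥ := by
    rw [Submodule.eq_bot_iff]
    intro f hf
    rw [Submodule.mem_orthogonal] at hf
    refine Lp.ext ?_
    refine (h.derivation.separating (Lp.memLp f).1 fun k H hk hk2 hk3 hH => ?_).trans
      (Lp.coeFn_zero ℝ 2 μ).symm
    refine ⟨hk2.integrable_mul (Lp.memLp f), ?_⟩
    rw [← hf (hk2.toLp k) (h.congr_mem (h.mem hk2 hk hH) hk2.coeFn_toLp.symm), L2.inner_def]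
    refine integral_congr_ae ?_
    filter_upwards [hk2.coeFn_toLp] with z hz
    rw [hz]
    simp [mul_comm]
  rw [← Submodule.topologicalClosure_eq_top_iff] at hK
  have hmem : hu.toLp u ∈ closure (K : Set (Lp ℝ 2 μ)) := by
    rw [← Submodule.topologicalClosure_coe, hK]
    trivial
  obtain ⟨k, hk, hd⟩ := Metric.mem_closure_iff.1 hmem (√ε) (Real.sqrt_pos.2 hε)
  refine ⟨k, hk, ?_⟩
  have h1 := (hu.sub (Lp.memLp k)).norm_toLp_sq
  rw [MemLp.toLp_sub hu (Lp.memLp k), Lp.toLp_coeFn, ← dist_eq_norm] at h1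
  calc ∫ z, (u z - k z) ^ 2 ∂μ = dist (hu.toLp u) k ^ 2 := by
        rw [h1]
        simp
    _ < √ε ^ 2 := by gcongr
    _ = ε := Real.sq_sqrt hε.le

/-- Functions and gradients are Cauchy in `L²(μ)` and `L²(μ; V)`, so limits `w` and `W` exist. What
needs proof is that `W` is the gradient of `w`, and this is closedness. -/
theorem complete (h : IsDirichletIntegral μ P D Γ) [CompleteSpace V] {u : ℕ → Ω → ℝ}
    (hu : ∀ n, u n ∈ D)
    (hc : ∀ ε > 0, ∃ N, ∀ m ≥ N, ∀ n ≥ N,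
      energyNormSq μ (energyForm μ Γ) (u m - u n) < ε) :
    ∃ w ∈ D, Tendsto (fun n => energyNormSq μ (energyForm μ Γ) (u n - w)) atTop (𝓝 0) := by
  choose hu2 F hF hF2 using fun n => h.mem_iff.1 (hu n)
  have hsq : ∀ m n, energyNormSq μ (energyForm μ Γ) (u m - u n) =
      1 / 2 * ‖(hF2 m).toLp - (hF2 n).toLp‖ ^ 2 + ‖(hu2 m).toLp - (hu2 n).toLp‖ ^ 2 := fun m n => by
    rw [h.energyNormSq_eq (h.sub_gradient (hF m) (hF n)), ← MemLp.toLp_sub, ← MemLp.toLp_sub,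
      MemLp.norm_toLp_sq, MemLp.norm_toLp_sq]
  have hcF : CauchySeq fun n => (hF2 n).toLp := by
    refine Metric.cauchySeq_iff.2 fun ε hε => ?_
    obtain ⟨N, hN⟩ := hc (1 / 2 * ε ^ 2) (by positivity)
    refine ⟨N, fun m hm n hn => lt_of_pow_lt_pow_left₀ 2 hε.le ?_⟩
    have := hN m hm n hn
    rw [hsq] at this
    rw [dist_eq_norm]
    nlinarith [sq_nonneg ‖(hu2 m).toLp - (hu2 n).toLp‖]
  have hcu : CauchySeq fun n => (hu2 n).toLp := by
    refine Metric.cauchySeq_iff.2 fun ε hε => ?_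
    obtain ⟨N, hN⟩ := hc (ε ^ 2) (by positivity)
    refine ⟨N, fun m hm n hn => lt_of_pow_lt_pow_left₀ 2 hε.le ?_⟩
    have := hN m hm n hn
    rw [hsq] at this
    rw [dist_eq_norm]
    nlinarith [sq_nonneg ‖(hF2 m).toLp - (hF2 n).toLp‖]
  obtain ⟨W, hW⟩ := cauchySeq_tendsto_of_complete hcF
  obtain ⟨w, hw⟩ := cauchySeq_tendsto_of_complete hcu
  have hlim : Tendsto (fun n => ‖(hu2 n).toLp - w‖ ^ 2 + ‖(hF2 n).toLp - W‖ ^ 2) atTop (𝓝 0) := by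
    have h1 := (tendsto_iff_norm_sub_tendsto_zero.1 hw).pow 2
    have h2 := (tendsto_iff_norm_sub_tendsto_zero.1 hW).pow 2
    simpa using h1.add h2
  -- Closedness asks for summable errors, so it is applied to a subsequence with errors below `2⁻ᵏ`.
  -- This suffices to identify `W`, since the full sequence already converges to `w` and `W`.
  obtain ⟨φ, hφ, hφ'⟩ := extraction_forall_of_eventually' (P := fun k n =>
      ‖(hu2 n).toLp - w‖ ^ 2 + ‖(hF2 n).toLp - W‖ ^ 2 < (1 / 2 : ℝ) ^ k) fun k => by
    obtain ⟨N, hN⟩ := eventually_atTop.1 (hlim.eventually (gt_mem_nhds (show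
      (0 : ℝ) < (1 / 2) ^ k by positivity)))
    exact ⟨N, hN⟩
  have hu2w : ∀ n, MemLp (fun z => u n z - w z) 2 μ := fun n => (hu2 n).sub (Lp.memLp w)
  have hF2W : ∀ n, MemLp (fun z => F n z - W z) 2 μ := fun n => (hF2 n).sub (Lp.memLp W)
  have hnu : ∀ n, ∫ z, ‖u n z - w z‖ ^ 2 ∂μ = ‖(hu2 n).toLp - w‖ ^ 2 := fun n => by
    rw [← (hu2w n).norm_toLp_sq]
    congr 2
    exact (MemLp.toLp_sub (hu2 n) (Lp.memLp w)).trans (by rw [Lp.toLp_coeFn])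
  have hnF : ∀ n, ∫ z, ‖F n z - W z‖ ^ 2 ∂μ = ‖(hF2 n).toLp - W‖ ^ 2 := fun n => by
    rw [← (hF2W n).norm_toLp_sq]
    congr 2
    exact (MemLp.toLp_sub (hF2 n) (Lp.memLp W)).trans (by rw [Lp.toLp_coeFn])
  have hPw : P w W := by
    refine h.derivation.closed (u := fun k => u (φ k)) (F := fun k => F (φ k))
      (fun k => (hu2 _).1) (fun k => hF _) (Lp.memLp w).1 (Lp.memLp W).1 ?_
    refine ne_top_of_le_ne_top (b := ∑' k : ℕ, ENNReal.ofReal ((1 / 2 : ℝ) ^ k)) ?_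
      (ENNReal.tsum_le_tsum fun k => ?_)
    · rw [← ENNReal.ofReal_tsum_of_nonneg (fun k => by positivity)
        (summable_geometric_of_lt_one (by norm_num) (by norm_num))]
      exact ENNReal.ofReal_ne_top
    · rw [lintegral_add_left' ((hu2w (φ k)).1.enorm.pow_const 2), (hu2w (φ k)).lintegral_enorm_sq,
        (hF2W (φ k)).lintegral_enorm_sq, hnu, hnF, ← ENNReal.ofReal_add (by positivity)
        (by positivity)]
      exact ENNReal.ofReal_le_ofReal (hφ' k).le
  refine ⟨w, h.mem (Lp.memLp w) hPw (Lp.memLp W), ?_⟩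
  have heq : ∀ n, energyNormSq μ (energyForm μ Γ) (u n - w) =
      1 / 2 * ‖(hF2 n).toLp - W‖ ^ 2 + ‖(hu2 n).toLp - w‖ ^ 2 := fun n => by
    rw [h.energyNormSq_eq (h.sub_gradient (hF n) hPw), ← hnu, ← hnF]
    rfl
  simp only [heq]
  refine squeeze_zero (fun n => by positivity) (fun n => ?_) hlim
  nlinarith [sq_nonneg ‖(hF2 n).toLp - W‖]

theorem isDirichletForm (h : IsDirichletIntegral μ P D Γ) [CompleteSpace V] : IsDirichletForm μ D
    (energyForm μ Γ) where
  memLp u hu := (h.mem_iff.1 hu).1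
  mem_congr u hu v huv := h.congr_mem hu huv
  form_congr u hu v hv w hw huv := by
    obtain ⟨-, F, hF, -⟩ := h.mem_iff.1 hu
    obtain ⟨-, H, hH, -⟩ := h.mem_iff.1 hw
    rw [h.energyForm_eq hF hH, h.energyForm_eq (h.derivation.congr hF huv ae_eq_rfl) hH]
  zero_mem := h.zero_mem
  add_mem u hu v hv := h.add_mem hu hv
  smul_mem c u hu := h.smul_mem c hu
  dense u hu ε hε := h.dense hu hε
  add_left u hu v hv w hw := by
    rw [energyForm, integral_congr_ae (h.gamma_add_left hu hv hw), energyForm, energyForm,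
      ← mul_add, ← integral_add (h.integrable_gamma hu hw) (h.integrable_gamma hv hw)]
    rfl
  smul_left c u hu v hv := by
    rw [energyForm, integral_congr_ae (h.gamma_smul_left c hu hv), energyForm, mul_left_comm,
      ← integral_const_mul c]
    rfl
  symm u hu v hv := by
    rw [energyForm, energyForm, integral_congr_ae (h.gamma_symm hu hv)]
  nonneg u hu := mul_nonneg (by norm_num) (integral_nonneg_of_ae (h.gamma_nonneg hu))
  complete u hu hc := h.complete hu hc
  markov_mem u hu := h.clip_mem le_rfl zero_le_one hu
  markov_le u hu := by
    obtain ⟨hu2, F, hF, hF2⟩ := h.mem_iff.1 hu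
    have hc := h.derivation.clip zero_le_one hu2.1 hF
    rw [h.energyForm_self hc, h.energyForm_self hF]
    refine mul_le_mul_of_nonneg_left (integral_mono_of_nonneg
      (Eventually.of_forall fun z => by positivity) (hF2.integrable_norm_pow two_ne_zero)
      (Eventually.of_forall fun z => ?_)) (by norm_num)
    exact pow_le_pow_left₀ (norm_nonneg _) (clip_gradient_norm_le z) 2

/-! ### The carré du champ operator and its uniqueness -/

/-- After the Leibniz rule the terms `f⟨K,G⟩` and `g⟨K,F⟩` cancel, while `k⟨F,G⟩` occurs twice and
absorbs the factor `½`. -/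
theorem characterization (h : IsDirichletIntegral μ P D Γ) {f g k : Ω → ℝ} (hf : f ∈ D)
    (hf' : MemLp f ⊤ μ) (hg : g ∈ D)
    (hg' : MemLp g ⊤ μ) (hk : k ∈ D) (hk' : MemLp k ⊤ μ) :
    energyForm μ Γ (f * k) g + energyForm μ Γ (g * k) f - energyForm μ Γ k (f * g) =
      ∫ z, k z * Γ f g z ∂μ := by
  obtain ⟨hf2, F, hF, hF2⟩ := h.mem_iff.1 hf
  obtain ⟨hg2, G, hG, hG2⟩ := h.mem_iff.1 hg
  obtain ⟨hk2, K, hK, hK2⟩ := h.mem_iff.1 hk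
  rw [h.energyForm_eq (h.mul_gradient hf' hk' hF hK) hG,
    h.energyForm_eq (h.mul_gradient hg' hk' hG hK) hF,
    h.energyForm_eq hK (h.mul_gradient hf' hg' hF hG), ← mul_add, ← mul_sub, ← integral_add,
    ← integral_sub, ← integral_const_mul]
  · refine integral_congr_ae ?_
    filter_upwards [h.eq_inner hF hG] with z hz
    rw [hz]
    simp only [inner_add_left, inner_add_right, real_inner_smul_left, real_inner_smul_right,
      real_inner_comm (F z) (K z), real_inner_comm (F z) (G z), real_inner_comm (G z) (K z)]
    ring
  · exact ((memLp_mul_gradient hf' hk' hF2 hK2).integrable_real_inner hG2).add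
      ((memLp_mul_gradient hg' hk' hG2 hK2).integrable_real_inner hF2)
  · exact hK2.integrable_real_inner (memLp_mul_gradient hf' hg' hF2 hG2)
  · exact (memLp_mul_gradient hf' hk' hF2 hK2).integrable_real_inner hG2
  · exact (memLp_mul_gradient hg' hk' hG2 hK2).integrable_real_inner hF2

/-- Cauchy–Schwarz on each term of `⟨Fₙ,Gₙ⟩ - ⟨A,B⟩ = ⟨Fₙ-A,Gₙ-B⟩ + ⟨Fₙ-A,B⟩ + ⟨A,Gₙ-B⟩`. -/
theorem continuous_gamma (h : IsDirichletIntegral μ P D Γ) {u v : ℕ → Ω → ℝ} (hu : ∀ n, u n ∈ D)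
    (hv : ∀ n, v n ∈ D) {a b : Ω → ℝ}
    (ha : a ∈ D) (hb : b ∈ D)
    (hua : Tendsto (fun n => energyNormSq μ (energyForm μ Γ) (u n - a)) atTop (𝓝 0))
    (hvb : Tendsto (fun n => energyNormSq μ (energyForm μ Γ) (v n - b)) atTop (𝓝 0)) :
    Tendsto (fun n => ∫ z, |Γ (u n) (v n) z - Γ a b z| ∂μ) atTop (𝓝 0) := by
  choose hu2 F hF hF2 using fun n => h.mem_iff.1 (hu n)
  choose hv2 G hG hG2 using fun n => h.mem_iff.1 (hv n)
  obtain ⟨ha2, A, hA, hA2⟩ := h.mem_iff.1 ha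
  obtain ⟨hb2, B, hB, hB2⟩ := h.mem_iff.1 hb
  have key : ∀ {u : ℕ → Ω → ℝ} {a : Ω → ℝ} {F : ℕ → Ω → V} {A : Ω → V}, (∀ n, P (u n) (F n)) →
      P a A → Tendsto (fun n => energyNormSq μ (energyForm μ Γ) (u n - a)) atTop (𝓝 0) →
      Tendsto (fun n => √(∫ z, ‖F n z - A z‖ ^ 2 ∂μ)) atTop (𝓝 0) := by
    intro u a F A hF hA hlim
    have h1 : Tendsto (fun n => ∫ z, ‖F n z - A z‖ ^ 2 ∂μ) atTop (𝓝 0) := by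
      refine squeeze_zero (fun n => by positivity) (fun n => ?_)
        (by simpa using hlim.const_mul 2)
      rw [h.energyNormSq_eq (h.sub_gradient (hF n) hA)]
      have : 0 ≤ ∫ z, ‖(u n - a) z‖ ^ 2 ∂μ := by positivity
      simp only [Pi.sub_apply] at this ⊢
      linarith
    rw [← Real.sqrt_zero]
    exact (Real.continuous_sqrt.tendsto 0).comp h1
  have hFA := key hF hA hua
  have hGB := key hG hB hvb
  refine squeeze_zero (fun n => by positivity) (g := fun n =>
    √(∫ z, ‖F n z - A z‖ ^ 2 ∂μ) * √(∫ z, ‖G n z - B z‖ ^ 2 ∂μ) +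
    √(∫ z, ‖F n z - A z‖ ^ 2 ∂μ) * √(∫ z, ‖B z‖ ^ 2 ∂μ) +
    √(∫ z, ‖A z‖ ^ 2 ∂μ) * √(∫ z, ‖G n z - B z‖ ^ 2 ∂μ)) (fun n => ?_) ?_
  · have hFs : MemLp (fun z => F n z - A z) 2 μ := (hF2 n).sub hA2
    have hGs : MemLp (fun z => G n z - B z) 2 μ := (hG2 n).sub hB2
    refine le_trans ?_ (add_le_add (add_le_add (hFs.integral_abs_inner_le hGs)
      (hFs.integral_abs_inner_le hB2)) (hA2.integral_abs_inner_le hGs))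
    have i1 := (hFs.integrable_real_inner hGs).abs
    have i2 := (hFs.integrable_real_inner hB2).abs
    have i3 := (hA2.integrable_real_inner hGs).abs
    refine le_of_le_of_eq ?_ ((integral_add (i1.add i2) i3).trans
      (congrArg (· + _) (integral_add i1 i2)))
    refine integral_mono_ae ((h.integrable_gamma (hu n) (hv n)).sub
      (h.integrable_gamma ha hb)).abs (((hFs.integrable_real_inner hGs).abs.add
      (hFs.integrable_real_inner hB2).abs).add (hA2.integrable_real_inner hGs).abs) ?_
    filter_upwards [h.eq_inner (hF n) (hG n), h.eq_inner hA hB] with z h1 h2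
    rw [h1, h2]
    refine le_trans (le_of_eq ?_) (abs_add_three _ _ _)
    congr 1
    simp only [inner_sub_left, inner_sub_right]
    ring
  · simpa using ((hFA.mul hGB).add (hFA.mul_const _)).add (hGB.const_mul _)

theorem isCarreDuChampOperator (h : IsDirichletIntegral μ P D Γ) : IsCarreDuChampOperator μ D
    (energyForm μ Γ) Γ where
  integrable _ hu _ hv := h.integrable_gamma hu hv
  add_left _ hu _ hv _ hw := h.gamma_add_left hu hv hw
  smul_left c _ hu _ hv := h.gamma_smul_left c hu hv
  symm _ hu _ hv := h.gamma_symm hu hv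
  nonneg _ hu := h.gamma_nonneg hu
  continuous _ _ hu hv _ ha _ hb hua hvb := h.continuous_gamma hu hv ha hb hua hvb
  characterization _ hf hf' _ hg hg' _ hk hk' := h.characterization hf hf' hg hg' hk hk'

/-- For bounded arguments both operators have the same integrals against every bounded `k` in the
domain, so `separating` identifies them. Truncations approximate arbitrary elements, and both
operators are continuous. -/
theorem unique (h : IsDirichletIntegral μ P D Γ) {Γ' : (Ω → ℝ) → (Ω → ℝ) → Ω → ℝ}
    (h' : IsCarreDuChampOperator μ D (energyForm μ Γ) Γ') {u v : Ω → ℝ} (hu : u ∈ D) (hv : v ∈ D) :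
    Γ' u v =ᵐ[μ] Γ u v := by
  have hbdd : ∀ {f g : Ω → ℝ}, f ∈ D → MemLp f ⊤ μ → g ∈ D → MemLp g ⊤ μ →
      Γ' f g =ᵐ[μ] Γ f g := by
    intro f g hf hf' hg hg'
    have hi := h'.integrable f hf g hg
    have hi' := h.integrable_gamma hf hg
    have hz : (fun z => Γ' f g z - Γ f g z) =ᵐ[μ] 0 := by
      refine h.derivation.separating (hi.sub hi').1 fun k K hK hk2 hk hK2 => ?_
      refine ⟨(hi.sub hi').mul_of_memLp_top hk, ?_⟩
      have hkD := h.mem hk2 hK hK2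
      simp only [mul_sub]
      rw [integral_sub (hi.mul_of_memLp_top hk) (hi'.mul_of_memLp_top hk),
        ← h'.characterization f hf hf' g hg hg' k hkD hk, h.characterization hf hf' hg hg' hkD hk,
        sub_self]
    filter_upwards [hz] with z hz
    exact sub_eq_zero.1 hz
  have hn : ∀ n : ℕ, (-n : ℝ) ≤ 0 ∧ (0 : ℝ) ≤ n := fun n => by
    have : (0 : ℝ) ≤ n := n.cast_nonneg
    constructor <;> linarith
  have hm : ∀ {u : Ω → ℝ}, u ∈ D → ∀ n : ℕ, (fun z => min (max (u z) (-n)) n) ∈ D :=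
    fun hu n => h.clip_mem (hn n).1 (hn n).2 hu
  have hm' : ∀ {u : Ω → ℝ}, u ∈ D → ∀ n : ℕ, MemLp (fun z => min (max (u z) (-n)) n) ⊤ μ :=
    fun hu n => (h.mem_iff.1 hu).1.clip_top ((hn n).1.trans (hn n).2)
  have l1 := h'.continuous _ _ (hm hu) (hm hv) u hu v hv (h.tendsto_energyNormSq_clip hu)
    (h.tendsto_energyNormSq_clip hv)
  have l2 := h.continuous_gamma (hm hu) (hm hv) hu hv (h.tendsto_energyNormSq_clip hu)
    (h.tendsto_energyNormSq_clip hv)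
  have hi := h'.integrable u hu v hv
  have hi' := h.integrable_gamma hu hv
  -- Triangle inequality through the common value of `Γ'` and `Γ` at the `n`-th truncations.
  have hle : ∫ z, |Γ' u v z - Γ u v z| ∂μ ≤ 0 := by
    refine ge_of_tendsto (by simpa using l1.add l2) (Eventually.of_forall fun n => ?_)
    have i1 := h'.integrable _ (hm hu n) _ (hm hv n)
    have i2 := h.integrable_gamma (hm hu n) (hm hv n)
    refine le_of_le_of_eq ?_ (integral_add (i1.sub hi).abs (i2.sub hi').abs)
    refine integral_mono_ae (hi.sub hi').abs ((i1.sub hi).abs.add (i2.sub hi').abs) ?_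
    filter_upwards [hbdd (hm hu n) (hm' hu n) (hm hv n) (hm' hv n)] with z hz
    simp only [hz]
    rw [abs_sub_comm (Γ _ _ z) (Γ' u v z)]
    exact abs_sub_le _ _ _
  have h0 := (integral_eq_zero_iff_of_nonneg (fun z => abs_nonneg _) (hi.sub hi').abs).1
    (le_antisymm hle (integral_nonneg fun z => abs_nonneg _))
  filter_upwards [h0] with z hz
  exact sub_eq_zero.1 (abs_eq_zero.1 hz)

theorem hasEnergyMeasure (h : IsDirichletIntegral μ P D Γ) [CompleteSpace V] :
    HasEnergyMeasure μ D (energyForm μ Γ) Γ where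
  isDirichletForm := h.isDirichletForm
  admits := by
    refine ⟨{ carrier := {f | f ∈ D ∧ MemLp f ⊤ μ}
              add_mem' := fun hf hg => ⟨h.add_mem hf.1 hg.1, hf.2.add hg.2⟩
              zero_mem' := ⟨h.zero_mem, MemLp.zero⟩
              smul_mem' := fun c f hf => ⟨h.smul_mem c hf.1, hf.2.const_smul c⟩ },
      fun f hf => hf, fun u hu ε hε => ?_, fun f hf => ?_⟩
    · obtain ⟨n, hn⟩ := ((h.tendsto_energyNormSq_clip hu).eventually (gt_mem_nhds hε)).exists
      have hn0 : (0 : ℝ) ≤ n := n.cast_nonneg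
      have hm := h.clip_mem (neg_nonpos.2 hn0) hn0 hu
      refine ⟨_, ⟨hm, (h.mem_iff.1 hu).1.clip_top (by linarith)⟩, ?_⟩
      obtain ⟨-, F, hF, -⟩ := h.mem_iff.1 hu
      obtain ⟨-, G, hG, -⟩ := h.mem_iff.1 hm
      rw [h.energyNormSq_eq (h.sub_gradient hG hF)] at hn
      rw [h.energyNormSq_eq (h.sub_gradient hF hG)]
      simpa only [Pi.sub_apply, norm_sub_rev] using hn
    · refine ⟨h.integrable_gamma hf.1 hf.1, fun k hk hk' => ?_⟩
      rw [← h.characterization hf.1 hf.2 hf.1 hf.2 hk hk', sq]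
      ring
  isOperator := h.isCarreDuChampOperator
  unique Γ' h' u hu v hv := h.unique h' hu hv

end IsDirichletIntegral

end Derivation

/-! ### Weighted measures and test functions -/

section Weight

variable {E : Type*} [NormedAddCommGroup E] [NormedSpace ℝ E] [FiniteDimensional ℝ E]
  [MeasurableSpace E] [BorelSpace E] {ν : Measure E} {U : Set E}
  {w : E → ℝ}

theorem restrict_absolutelyContinuous_weight {E : Type*} [MeasurableSpace E] {ν : Measure E}
    {U : Set E} {w : E → ℝ} (hw : Measurable w) (hw₀ : ∀ᵐ z ∂ν.restrict U, 0 < w z) :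
    ν.restrict U ≪ (ν.restrict U).withDensity fun z => ENNReal.ofReal (w z) := by
  refine withDensity_absolutelyContinuous' hw.ennreal_ofReal.aemeasurable ?_
  filter_upwards [hw₀] with z hz
  simpa using hz

/-- Test functions supported in `U` separate functions, for a measure with a positive density
on `U`. -/
theorem ae_eq_zero_of_forall_testFunction (hU : IsOpen U) (hw : Measurable w)
    (hw₀ : ∀ z ∈ U, 0 < w z) {f : E → ℝ}
    (hf : AEStronglyMeasurable f ((ν.restrict U).withDensity fun z => ENNReal.ofReal (w z)))
    (h : ∀ g : E → ℝ, ContDiff ℝ ((⊤ : ℕ∞) : WithTop ℕ∞) g → HasCompactSupport g → tsupport g ⊆ U →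
      Integrable (g * f) ((ν.restrict U).withDensity fun z => ENNReal.ofReal (w z)) ∧
      ∫ z, g z * f z ∂((ν.restrict U).withDensity fun z => ENNReal.ofReal (w z)) = 0) :
    f =ᵐ[(ν.restrict U).withDensity fun z => ENNReal.ofReal (w z)] 0 := by
  have hm : Measurable fun z => ENNReal.ofReal (w z) := hw.ennreal_ofReal
  have hw₀' : ∀ᵐ z ∂ν.restrict U, 0 < w z := by
    filter_upwards [ae_restrict_mem hU.measurableSet] with z hz using hw₀ z hz
  have hf' := hf.mono_ac (restrict_absolutelyContinuous_weight hw hw₀')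
  set F : E → ℝ := fun z => (ENNReal.ofReal (w z)).toReal * f z with hF
  have hFm : AEStronglyMeasurable F (ν.restrict U) :=
    hm.ennreal_toReal.aestronglyMeasurable.mul hf'
  have hint : ∀ g : E → ℝ, ContDiff ℝ ((⊤ : ℕ∞) : WithTop ℕ∞) g → HasCompactSupport g →
      tsupport g ⊆ U → Integrable (fun z => g z * F z) (ν.restrict U) := by
    intro g hg hg' hgU
    have := (integrable_withDensity_iff_integrable_smul' hm
      (Eventually.of_forall fun z => ENNReal.ofReal_lt_top)).1 (h g hg hg' hgU).1
    refine this.congr (Eventually.of_forall fun z => ?_)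
    simp only [Pi.mul_apply, smul_eq_mul, hF]
    ring
  -- Take a test function `g` with `g c = 1`. On the neighbourhood where `g > 1/2` one has `|F| ≤
  -- 2|gF|`, and `gF` is integrable by assumption.
  have hloc : LocallyIntegrableOn F U ν := by
    intro c hc
    obtain ⟨g, hgU, hgc, hgs, -, hg1⟩ := exists_contDiff_tsupport_subset (n := ⊤) (hU.mem_nhds hc)
    have hN : IsOpen {z | 1 / 2 < g z} := isOpen_lt continuous_const hgs.continuous
    have hNU : {z | 1 / 2 < g z} ⊆ U := fun z hz => hgU (subset_tsupport g fun h0 => by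
      have : 1 / 2 < g z := hz
      rw [h0] at this
      norm_num at this)
    refine ⟨_, mem_nhdsWithin_of_mem_nhds (hN.mem_nhds (show 1 / 2 < g c by rw [hg1]; norm_num)),
      ?_⟩
    have hi := (hint g hgs hgc hgU).mono_measure (Measure.restrict_mono_set ν hNU)
    refine Integrable.mono (hi.const_mul 2) (hFm.mono_set hNU) ?_
    filter_upwards [ae_restrict_mem hN.measurableSet] with z hz
    have hz' : 1 / 2 < g z := hz
    rw [norm_mul 2, norm_mul (g z), ← mul_assoc]
    refine le_mul_of_one_le_left (norm_nonneg (F z)) ?_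
    rw [Real.norm_eq_abs, Real.norm_eq_abs, abs_of_pos (by norm_num), abs_of_pos (by linarith)]
    linarith
  have hzero := hU.ae_eq_zero_of_integral_contDiff_smul_eq_zero hloc fun g hg hg' hgU => by
    have h2 := (h g hg hg' hgU).2
    rw [integral_withDensity_eq_integral_toReal_smul hm
      (Eventually.of_forall fun z => ENNReal.ofReal_lt_top)] at h2
    rw [← h2, ← setIntegral_eq_integral_of_forall_compl_eq_zero (s := U)]
    · refine integral_congr_ae (Eventually.of_forall fun z => ?_)
      simp only [smul_eq_mul, hF]
      ring
    · intro z hz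
      rw [image_eq_zero_of_notMem_tsupport fun h' => hz (hgU h'), zero_smul]
  refine (withDensity_absolutelyContinuous _ _).ae_le ?_
  filter_upwards [(ae_restrict_iff' hU.measurableSet).2 hzero, hw₀'] with z hz hwz
  rw [hF] at hz
  simpa [ENNReal.toReal_ofReal hwz.le, hwz.ne'] using hz

/-- The weight may be singular at the boundary of `U`, here the axis, but it is bounded on compact
subsets of `U`; these therefore have finite weighted measure. -/
theorem memLp_weight_of_isCompact [IsLocallyFiniteMeasure ν] {W : Type*} [NormedAddCommGroup W]
    {K : Set E} {k : E → W} {p : ENNReal} (hwc : ContinuousOn w U) (hK : IsCompact K) (hKU : K ⊆ U)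
    (hk : AEStronglyMeasurable k ((ν.restrict U).withDensity fun z => ENNReal.ofReal (w z)))
    (hkc : ContinuousOn k K) (hk₀ : ∀ z ∉ K, k z = 0) :
    MemLp k p ((ν.restrict U).withDensity fun z => ENNReal.ofReal (w z)) := by
  obtain ⟨C, hC⟩ := hK.exists_bound_of_continuousOn (hwc.mono hKU)
  obtain ⟨B, hB⟩ := hK.exists_bound_of_continuousOn hkc
  have hfin : ((ν.restrict U).withDensity fun z => ENNReal.ofReal (w z)) K < ⊤ := by
    rw [withDensity_apply _ hK.measurableSet]
    calc ∫⁻ z in K, ENNReal.ofReal (w z) ∂ν.restrict U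
        ≤ ∫⁻ _ in K, ENNReal.ofReal C ∂ν.restrict U :=
          setLIntegral_mono' hK.measurableSet fun z hz =>
            ENNReal.ofReal_le_ofReal ((le_abs_self _).trans (hC z hz))
      _ = ENNReal.ofReal C * ν.restrict U K := by simp
      _ < ⊤ := ENNReal.mul_lt_top ENNReal.ofReal_lt_top
        ((Measure.restrict_le_self K).trans_lt hK.measure_lt_top)
  have : k = K.indicator k := by
    ext z
    by_cases hz : z ∈ K
    · rw [Set.indicator_of_mem hz]
    · rw [Set.indicator_of_notMem hz, hk₀ z hz]
  rw [this, memLp_indicator_iff_restrict hK.measurableSet]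
  have : IsFiniteMeasure
      (((ν.restrict U).withDensity fun z => ENNReal.ofReal (w z)).restrict K) :=
    ⟨by rwa [Measure.restrict_apply_univ]⟩
  refine MemLp.of_bound hk.restrict B ?_
  filter_upwards [ae_restrict_mem hK.measurableSet] with z hz using hB z hz

end Weight

/-! ### Gradients along the coordinate lines of a strip -/

section Plane

variable {J : Set ℝ} {u v : ℝ × ℝ → ℝ} {G H : ℝ × ℝ → ℝ × ℝ}

theorem volume_restrict_univ_prod (J : Set ℝ) :
    (volume.restrict (Set.univ ×ˢ J) : Measure (ℝ × ℝ)) =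
      (volume : Measure ℝ).prod (volume.restrict J) := by
  rw [Measure.volume_eq_prod, ← Measure.prod_restrict, Measure.restrict_univ]

theorem ae_lines {p : ℝ × ℝ → Prop}
    (h : ∀ᵐ z ∂(volume.restrict (Set.univ ×ˢ J) : Measure (ℝ × ℝ)), p z) :
    (∀ᵐ y ∂volume.restrict J, ∀ᵐ x ∂volume.restrict Set.univ, p (x, y)) ∧
      ∀ᵐ x, ∀ᵐ y ∂volume.restrict J, p (x, y) := by
  rw [volume_restrict_univ_prod] at h
  rw [Measure.restrict_univ]
  exact ⟨ae_ae_of_ae_prod_symm h, Measure.ae_ae_of_ae_prod h⟩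

theorem HasACGradient.congr (h : HasACGradient J u G)
    (huv : u =ᵐ[volume.restrict (Set.univ ×ˢ J)] v) (hH : Measurable H)
    (hGH : G =ᵐ[volume.restrict (Set.univ ×ˢ J)] H) : HasACGradient J v H := by
  refine ⟨hH, ?_, ?_⟩
  · filter_upwards [h.2.1, (ae_lines huv).1, (ae_lines hGH).1] with y h1 h2 h3
    exact h1.congr h2 (h3.mono fun x hx => congrArg Prod.fst hx)
  · filter_upwards [h.2.2, (ae_lines huv).2, (ae_lines hGH).2] with x h1 h2 h3
    exact h1.congr h2 (h3.mono fun x hx => congrArg Prod.snd hx)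

theorem HasACGradient.add (hu : HasACGradient J u G) (hv : HasACGradient J v H) :
    HasACGradient J (u + v) (G + H) := by
  refine ⟨hu.1.add hv.1, ?_, ?_⟩
  · filter_upwards [hu.2.1, hv.2.1] with y h1 h2 using h1.add h2
  · filter_upwards [hu.2.2, hv.2.2] with y h1 h2 using h1.add h2

theorem HasACGradient.smul (c : ℝ) (hu : HasACGradient J u G) :
    HasACGradient J (c • u) (c • G) := by
  refine ⟨hu.1.const_smul c, ?_, ?_⟩
  · filter_upwards [hu.2.1] with y h1 using h1.const_mul c
  · filter_upwards [hu.2.2] with y h1 using h1.const_mul c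

theorem HasACGradient.mul (hum : Measurable u) (hvm : Measurable v) (hu : HasACGradient J u G)
    (hv : HasACGradient J v H) : HasACGradient J (u * v) (fun z => u z • H z + v z • G z) := by
  refine ⟨(hum.smul hv.1).add (hvm.smul hu.1), ?_, ?_⟩
  · filter_upwards [hu.2.1, hv.2.1] with y h1 h2 using h1.mul h2
  · filter_upwards [hu.2.2, hv.2.2] with y h1 h2 using h1.mul h2

theorem HasACGradient.clip (hJ : IsOpen J) {a b : ℝ} (hab : a ≤ b) (hum : Measurable u)
    (hu : HasACGradient J u G) : HasACGradient J (fun z => min (max (u z) a) b)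
      (fun z => if a < u z ∧ u z < b then G z else 0) := by
  refine ⟨Measurable.ite ((measurableSet_lt measurable_const hum).inter
    (measurableSet_lt hum measurable_const)) hu.1 measurable_const, ?_, ?_⟩
  · filter_upwards [hu.2.1] with y h1
    refine (h1.clip isOpen_univ hab).congr ae_eq_rfl (Eventually.of_forall fun x => ?_)
    simp only
    split_ifs <;> rfl
  · filter_upwards [hu.2.2] with x h1
    refine (h1.clip hJ hab).congr ae_eq_rfl (Eventually.of_forall fun y => ?_)
    simp only
    split_ifs <;> rfl

/-- Uniqueness on each line becomes uniqueness almost everywhere in the plane by Fubini. This needs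
jointly measurable gradients, which is why `HasACGradient` includes measurability. -/
theorem HasACGradient.unique (hJ : IsOpen J) (hG : HasACGradient J u G)
    (hH : HasACGradient J u H) : G =ᵐ[volume.restrict (Set.univ ×ˢ J)] H := by
  have h1 : ∀ᵐ z ∂(volume.restrict (Set.univ ×ˢ J) : Measure (ℝ × ℝ)), (G z).1 = (H z).1 := by
    rw [volume_restrict_univ_prod, ← Measure.prod_swap, ae_map_iff measurable_swap.aemeasurable
      (measurableSet_eq_fun hG.1.fst hH.1.fst)]
    refine (Measure.ae_prod_iff_ae_ae (measurableSet_eq_fun (hG.1.fst.comp measurable_swap)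
      (hH.1.fst.comp measurable_swap))).2 ?_
    filter_upwards [hG.2.1, hH.2.1] with y h1 h2
    simpa only [Measure.restrict_univ] using! h1.unique isOpen_univ h2
  have h2 : ∀ᵐ z ∂(volume.restrict (Set.univ ×ˢ J) : Measure (ℝ × ℝ)), (G z).2 = (H z).2 := by
    rw [volume_restrict_univ_prod,
      Measure.ae_prod_iff_ae_ae (measurableSet_eq_fun hG.1.snd hH.1.snd)]
    filter_upwards [hG.2.2, hH.2.2] with x h1 h2 using h1.unique hJ h2
  filter_upwards [h1, h2] with z hz hz' using Prod.ext hz hz'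

theorem hasACGradient_acGradient (h : ∃ G, HasACGradient J u G) :
    HasACGradient J u (acGradient J u) := by
  rw [acGradient, dif_pos h]
  exact h.choose_spec

theorem ContDiff.hasACGradient (hu : ContDiff ℝ 1 u) :
    HasACGradient J u fun z => (fderiv ℝ u z (1, 0), fderiv ℝ u z (0, 1)) := by
  have hc := hu.continuous_fderiv one_ne_zero
  have hd := hu.differentiable one_ne_zero
  refine ⟨((hc.clm_apply continuous_const).prodMk (hc.clm_apply continuous_const)).measurable,
    Eventually.of_forall fun y => ?_, Eventually.of_forall fun x => ?_⟩
  · have h1 : ContDiff ℝ 1 fun x => u (x, y) := hu.comp (contDiff_id.prodMk contDiff_const)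
    refine h1.hasACDerivOn.congr ae_eq_rfl (Eventually.of_forall fun x => ?_)
    exact ((hd (x, y)).hasFDerivAt.comp_hasDerivAt x
      ((hasDerivAt_id x).prodMk (hasDerivAt_const x y))).deriv
  · have h1 : ContDiff ℝ 1 fun y => u (x, y) := hu.comp (contDiff_const.prodMk contDiff_id)
    refine h1.hasACDerivOn.congr ae_eq_rfl (Eventually.of_forall fun y => ?_)
    exact ((hd (x, y)).hasFDerivAt.comp_hasDerivAt y
      ((hasDerivAt_const y x).prodMk (hasDerivAt_id y))).deriv

/-- Gradients along coordinate lines are closed with respect to almost everywhere convergence of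
the functions and summable weighted `L²`-convergence of the partial derivatives. -/
theorem HasACGradient.of_summable (hJ : IsOpen J) (hJ' : J.OrdConnected) {u : ℕ → ℝ × ℝ → ℝ}
    {G : ℕ → ℝ × ℝ → ℝ × ℝ} {w : ℝ × ℝ → ℝ} {W : ℝ × ℝ → ℝ × ℝ}
    (h : ∀ n, HasACGradient J (u n) (G n)) (hW : Measurable W)
    {κ κ' : ℝ → ℝ} (hκ : Measurable κ) (hκ₀ : ∀ x, x ≠ 0 → 0 < κ x)
    (hκi : ∀ a b, IntervalIntegrable (fun x => (κ x)⁻¹) volume a b)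
    (hκ' : Measurable κ') (hκ₀' : ∀ x, x ≠ 0 → 0 < κ' x)
    (hu : ∀ᵐ z ∂(volume.restrict (Set.univ ×ˢ J) : Measure (ℝ × ℝ)),
      Tendsto (fun n => u n z) atTop (𝓝 (w z)))
    (hs : ∑' n, ∫⁻ z in Set.univ ×ˢ J, ENNReal.ofReal (κ z.1) * ‖(G n z).1 - (W z).1‖ₑ ^ 2 ≠ ⊤)
    (hs' : ∑' n, ∫⁻ z in Set.univ ×ˢ J, ENNReal.ofReal (κ' z.1) * ‖(G n z).2 - (W z).2‖ₑ ^ 2 ≠ ⊤) :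
    HasACGradient J w W := by
  have hne : ∀ᵐ x : ℝ, x ≠ 0 := by simp [ae_iff]
  have hG := fun n => (h n).1
  rw [volume_restrict_univ_prod] at hs hs'
  refine ⟨hW, ?_, ?_⟩
  · filter_upwards [ae_all_iff.2 fun n => (h n).2.1, (ae_lines hu).1,
      ae_tendsto_lintegral_section_symm (fun n => ((hκ.comp measurable_fst).ennreal_ofReal.mul
        (((hG n).fst.sub hW.fst).enorm.pow_const 2)).aemeasurable) hs] with y h1 h2 h3
    refine HasACDerivOn.of_tendsto_sq isOpen_univ Set.ordConnected_univ h1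
      (fun n => ((hG n).fst.comp measurable_prodMk_right).aemeasurable)
      (hW.fst.comp measurable_prodMk_right).aemeasurable hκ ?_ (fun a _ b _ => hκi a b) h2 ?_
    · rw [Measure.restrict_univ]
      filter_upwards [hne] with x hx using hκ₀ x hx
    · rw [Measure.restrict_univ]
      exact h3
  · filter_upwards [ae_all_iff.2 fun n => (h n).2.2, (ae_lines hu).2, hne,
      ae_tendsto_lintegral_section (fun n => ((hκ'.comp measurable_fst).ennreal_ofReal.mul
        (((hG n).snd.sub hW.snd).enorm.pow_const 2)).aemeasurable) hs'] with x h1 h2 hx h3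
    -- On a vertical line the weight is the constant `κ' x`, so positivity for `x ≠ 0` replaces any
    -- integrability condition on `κ'⁻¹`.
    exact HasACDerivOn.of_tendsto_sq hJ hJ' h1
      (fun n => ((hG n).snd.comp measurable_prodMk_left).aemeasurable)
      (hW.snd.comp measurable_prodMk_left).aemeasurable measurable_const
      (Eventually.of_forall fun _ => hκ₀' x hx) (fun a _ b _ => by simp) h2 h3

end Plane

/-! ### The Dirichlet integral on a strip

The SABR form and its time change are instances of one form on `ℝ × J`, with frame fields
`s(y) |x|^β ∂ₓ + …` scaled by a function `s` of the second coordinate. -/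

section Strip

/-- The coordinates of a covector in the frame dual to an orthonormal coframe. -/
def stripFrame (ρ β : ℝ) (s : ℝ → ℝ) (z : ℝ × ℝ) : ℝ × ℝ →ₗ[ℝ] EuclideanSpace ℝ (Fin 2) where
  toFun ξ := !₂[s z.2 * (|z.1| ^ β * ξ.1 + ρ * ξ.2), s z.2 * (√(1 - ρ ^ 2) * ξ.2)]
  map_add' ξ η := by
    ext i
    fin_cases i <;> simp <;> ring
  map_smul' c ξ := by
    ext i
    fin_cases i <;> simp <;> ring

/-- The covector with given coordinates in the frame. -/
def stripCoframe (ρ β : ℝ) (s : ℝ → ℝ) (z : ℝ × ℝ) (η : EuclideanSpace ℝ (Fin 2)) : ℝ × ℝ :=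
  ((η 0 - ρ / √(1 - ρ ^ 2) * η 1) / (s z.2 * |z.1| ^ β), η 1 / (s z.2 * √(1 - ρ ^ 2)))

def stripWeight (ρ γ : ℝ) (s : ℝ → ℝ) (z : ℝ × ℝ) : ℝ := 1 / (√(1 - ρ ^ 2) * |z.1| ^ γ * s z.2 ^ 2)

def stripMeasure (ρ γ : ℝ) (s : ℝ → ℝ) (J : Set ℝ) : Measure (ℝ × ℝ) :=
  (volume.restrict (Set.univ ×ˢ J)).withDensity fun z =>
    ENNReal.ofReal (stripWeight ρ γ s z)

def stripGamma (ρ β : ℝ) (s : ℝ → ℝ) (J : Set ℝ) (u v : ℝ × ℝ → ℝ) (z : ℝ × ℝ) : ℝ :=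
  s z.2 ^ 2 * tcSymbol ρ β z (acDifferential J u z) (acDifferential J v z)

def stripDomain (ρ β γ : ℝ) (s : ℝ → ℝ) (J : Set ℝ) : Set (ℝ × ℝ → ℝ) :=
  {u | MemLp u 2 (stripMeasure ρ γ s J) ∧ (∃ G, HasACGradient J u G) ∧
    Integrable (stripGamma ρ β s J u u) (stripMeasure ρ γ s J)}

/-- `F` is the gradient of `u` in the orthonormal frame. -/
def HasStripGradient (ρ β γ : ℝ) (s : ℝ → ℝ) (J : Set ℝ) (u : ℝ × ℝ → ℝ)
    (F : ℝ × ℝ → EuclideanSpace ℝ (Fin 2)) : Prop :=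
  ∃ G, HasACGradient J u G ∧ F =ᵐ[stripMeasure ρ γ s J] fun z => stripFrame ρ β s z (G z)

/-- The conditions on the parameters under which the form on `ℝ × J` is closed. -/
structure IsStripAdmissible (ρ β γ : ℝ) (s : ℝ → ℝ) (J : Set ℝ) : Prop where
  sq_lt_one : ρ ^ 2 < 1
  nonneg : 0 ≤ β
  lt : -1 < γ - 2 * β
  isOpen : IsOpen J
  ordConnected : J.OrdConnected
  continuous : Continuous s
  pos : ∀ y ∈ J, 0 < s y

variable {ρ β γ : ℝ} {s : ℝ → ℝ} {J : Set ℝ}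

theorem abs_rpow_two_mul (x β : ℝ) : |x| ^ (2 * β) = (|x| ^ β) ^ 2 := by
  rw [mul_comm, Real.rpow_mul (abs_nonneg x), Real.rpow_two]

theorem measurable_abs_rpow (r : ℝ) : Measurable fun x : ℝ => |x| ^ r := by
  fun_prop

theorem measurable_stripFrame (hs : Continuous s) {G : ℝ × ℝ → ℝ × ℝ} (hG : Measurable G) :
    Measurable fun z => stripFrame ρ β s z (G z) := by
  refine (WithLp.measurable_toLp 2 _).comp (measurable_pi_lambda _ fun i => ?_)
  have h1 : Measurable fun z : ℝ × ℝ => |z.1| ^ β := (measurable_abs_rpow β).comp measurable_fst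
  have h2 : Measurable fun z : ℝ × ℝ => s z.2 := hs.measurable.comp measurable_snd
  fin_cases i
  · exact h2.mul ((h1.mul hG.fst).add (hG.snd.const_mul ρ))
  · exact h2.mul (hG.snd.const_mul _)

theorem measurable_stripCoframe (hs : Continuous s) {F : ℝ × ℝ → EuclideanSpace ℝ (Fin 2)}
    (hF : Measurable F) : Measurable fun z => stripCoframe ρ β s z (F z) := by
  have h1 : Measurable fun z : ℝ × ℝ => |z.1| ^ β := (measurable_abs_rpow β).comp measurable_fst
  have h2 : Measurable fun z : ℝ × ℝ => s z.2 := hs.measurable.comp measurable_snd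
  have h3 : ∀ i, Measurable fun z => F z i := fun i =>
    (measurable_pi_apply i).comp ((WithLp.measurable_ofLp 2 _).comp hF)
  exact (((h3 0).sub ((h3 1).const_mul _)).div (h2.mul h1)).prodMk ((h3 1).div (h2.mul_const _))

theorem sqrt_one_sub_sq_pos (hρ : ρ ^ 2 < 1) : 0 < √(1 - ρ ^ 2) :=
  Real.sqrt_pos.2 (by linarith)

theorem stripFrame_stripCoframe (hρ : ρ ^ 2 < 1) {z : ℝ × ℝ} (hx : z.1 ≠ 0) (hy : s z.2 ≠ 0)
    (η : EuclideanSpace ℝ (Fin 2)) : stripFrame ρ β s z (stripCoframe ρ β s z η) = η := by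
  have h1 : |z.1| ^ β ≠ 0 := (Real.rpow_pos_of_pos (abs_pos.2 hx) β).ne'
  have h2 := (sqrt_one_sub_sq_pos hρ).ne'
  ext i
  fin_cases i
  · simp only [stripFrame, stripCoframe, LinearMap.coe_mk, AddHom.coe_mk]
    simp
    field_simp
    ring
  · simp only [stripFrame, stripCoframe, LinearMap.coe_mk, AddHom.coe_mk]
    simp
    field_simp

/-- The frame is a Cholesky factor of the symbol, by `ρ² + √(1-ρ²)² = 1`. -/
theorem inner_stripFrame (hρ : ρ ^ 2 < 1) (z ξ η : ℝ × ℝ) :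
    inner ℝ (stripFrame ρ β s z ξ) (stripFrame ρ β s z η) =
      s z.2 ^ 2 * (|z.1| ^ (2 * β) * (ξ.1 * η.1) + ρ * |z.1| ^ β * (ξ.1 * η.2 + ξ.2 * η.1) +
        ξ.2 * η.2) := by
  have h := Real.sq_sqrt (show 0 ≤ 1 - ρ ^ 2 by linarith)
  rw [abs_rpow_two_mul]
  simp only [stripFrame, LinearMap.coe_mk, AddHom.coe_mk, PiLp.inner_apply, Fin.sum_univ_two]
  simp
  linear_combination s z.2 ^ 2 * ξ.2 * η.2 * h

/-- Completing the square in `ξ.2` here, and in `ξ.1` in the next lemma, bounds each partial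
derivative separately by the energy density. -/
theorem norm_sq_stripFrame (hρ : ρ ^ 2 < 1) (z ξ : ℝ × ℝ) :
    ‖stripFrame ρ β s z ξ‖ ^ 2 = s z.2 ^ 2 * ((1 - ρ ^ 2) * (|z.1| ^ (2 * β) * ξ.1 ^ 2) +
      (ρ * |z.1| ^ β * ξ.1 + ξ.2) ^ 2) := by
  rw [← real_inner_self_eq_norm_sq, inner_stripFrame hρ, abs_rpow_two_mul]
  ring

theorem norm_sq_stripFrame' (hρ : ρ ^ 2 < 1) (z ξ : ℝ × ℝ) :
    ‖stripFrame ρ β s z ξ‖ ^ 2 = s z.2 ^ 2 * ((1 - ρ ^ 2) * ξ.2 ^ 2 +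
      (|z.1| ^ β * ξ.1 + ρ * ξ.2) ^ 2) := by
  rw [← real_inner_self_eq_norm_sq, inner_stripFrame hρ, abs_rpow_two_mul]
  ring

/-- The part of the strip away from the axis. -/
def stripRegular (J : Set ℝ) : Set (ℝ × ℝ) := {z | z.1 ≠ 0 ∧ z.2 ∈ J}

theorem isOpen_stripRegular (hJ : IsOpen J) : IsOpen (stripRegular J) :=
  (isOpen_ne.preimage continuous_fst).inter (hJ.preimage continuous_snd)

/-- The axis is a null set. Once it is removed, the weight is continuous and positive on an open
set, which allows test functions. -/
theorem restrict_strip_eq (J : Set ℝ) :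
    (volume.restrict (Set.univ ×ˢ J) : Measure (ℝ × ℝ)) = volume.restrict (stripRegular J) := by
  refine Measure.restrict_congr_set ?_
  have h : ∀ᵐ z : ℝ × ℝ, z.1 ≠ 0 := by
    have h0 : ∀ᵐ x : ℝ, x ≠ 0 := by simp [ae_iff]
    rw [Measure.volume_eq_prod]
    exact Measure.quasiMeasurePreserving_fst.ae h0
  filter_upwards [h] with z hz
  refine propext ⟨fun hz' => ⟨hz, hz'.2⟩, fun hz' => ⟨trivial, hz'.2⟩⟩

theorem stripMeasure_eq (ρ γ : ℝ) (s : ℝ → ℝ) (J : Set ℝ) :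
    stripMeasure ρ γ s J = (volume.restrict (stripRegular J)).withDensity
      fun z => ENNReal.ofReal (stripWeight ρ γ s z) := by
  rw [stripMeasure, restrict_strip_eq]

theorem measurable_stripWeight (hs : Continuous s) : Measurable (stripWeight ρ γ s) := by
  have h1 : Measurable fun z : ℝ × ℝ => |z.1| ^ γ := (measurable_abs_rpow γ).comp measurable_fst
  have h2 : Measurable fun z : ℝ × ℝ => s z.2 := hs.measurable.comp measurable_snd
  exact ((h1.const_mul _).mul (h2.pow_const 2)).const_div 1

namespace IsStripAdmissible

theorem stripWeight_pos (h : IsStripAdmissible ρ β γ s J) {z : ℝ × ℝ} (hz : z ∈ stripRegular J) :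
    0 < stripWeight ρ γ s z := by
  have h1 := sqrt_one_sub_sq_pos h.sq_lt_one
  have h2 := h.pos z.2 hz.2
  have h3 : 0 < |z.1| ^ γ := Real.rpow_pos_of_pos (abs_pos.2 hz.1) γ
  exact one_div_pos.2 (by positivity)

theorem continuousOn_stripWeight (h : IsStripAdmissible ρ β γ s J) :
    ContinuousOn (stripWeight ρ γ s) (stripRegular J) := by
  refine continuousOn_const.div (ContinuousOn.mul (continuousOn_const.mul ?_)
    ((h.continuous.comp continuous_snd).pow 2).continuousOn) fun z hz => ?_
  · exact (continuous_fst.abs.continuousOn).rpow_const fun z hz => Or.inl (abs_pos.2 hz.1).ne'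
  · exact (one_div_pos.1 (h.stripWeight_pos hz)).ne'

theorem ae_mem_stripRegular (h : IsStripAdmissible ρ β γ s J) :
    ∀ᵐ z ∂(volume.restrict (Set.univ ×ˢ J) : Measure (ℝ × ℝ)), z ∈ stripRegular J := by
  rw [restrict_strip_eq]
  exact ae_restrict_mem (isOpen_stripRegular h.isOpen).measurableSet

theorem absolutelyContinuous (h : IsStripAdmissible ρ β γ s J) :
    volume.restrict (Set.univ ×ˢ J) ≪ stripMeasure ρ γ s J := by
  rw [stripMeasure_eq, restrict_strip_eq]
  refine restrict_absolutelyContinuous_weight (measurable_stripWeight h.continuous) ?_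
  filter_upwards [ae_restrict_mem (isOpen_stripRegular h.isOpen).measurableSet] with z hz
  exact h.stripWeight_pos hz

theorem absolutelyContinuous' (ρ γ : ℝ) (s : ℝ → ℝ) (J : Set ℝ) :
    stripMeasure ρ γ s J ≪ volume.restrict (Set.univ ×ˢ J) :=
  withDensity_absolutelyContinuous _ _

/-- Gradients of products and truncations involve the function itself, so their measurability
requires a measurable representative. -/
theorem exists_measurable (h : IsStripAdmissible ρ β γ s J) {u : ℝ × ℝ → ℝ}
    (hu : AEStronglyMeasurable u (stripMeasure ρ γ s J)) {F : ℝ × ℝ → EuclideanSpace ℝ (Fin 2)}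
    (hF : HasStripGradient ρ β γ s J u F) :
    ∃ (v : ℝ × ℝ → ℝ) (G : ℝ × ℝ → ℝ × ℝ), Measurable v ∧ u =ᵐ[stripMeasure ρ γ s J] v ∧
      HasACGradient J v G ∧ F =ᵐ[stripMeasure ρ γ s J] fun z => stripFrame ρ β s z (G z) := by
  obtain ⟨G, hG, hFG⟩ := hF
  exact ⟨hu.mk u, G, hu.stronglyMeasurable_mk.measurable, hu.ae_eq_mk,
    hG.congr (h.absolutelyContinuous.ae_le hu.ae_eq_mk) hG.1 ae_eq_rfl, hFG⟩

theorem congr (h : IsStripAdmissible ρ β γ s J) {u v : ℝ × ℝ → ℝ}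
    {F G : ℝ × ℝ → EuclideanSpace ℝ (Fin 2)} (hF : HasStripGradient ρ β γ s J u F)
    (huv : u =ᵐ[stripMeasure ρ γ s J] v) (hFG : F =ᵐ[stripMeasure ρ γ s J] G) :
    HasStripGradient ρ β γ s J v G := by
  obtain ⟨H, hH, hFH⟩ := hF
  exact ⟨H, hH.congr (h.absolutelyContinuous.ae_le huv) hH.1 ae_eq_rfl, hFG.symm.trans hFH⟩

theorem stripFrame_closed (h : IsStripAdmissible ρ β γ s J) {u : ℕ → ℝ × ℝ → ℝ}
    {F : ℕ → ℝ × ℝ → EuclideanSpace ℝ (Fin 2)} {w : ℝ × ℝ → ℝ}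
    {W : ℝ × ℝ → EuclideanSpace ℝ (Fin 2)}
    (hu : ∀ n, AEStronglyMeasurable (u n) (stripMeasure ρ γ s J))
    (hF : ∀ n, HasStripGradient ρ β γ s J (u n) (F n))
    (hw : AEStronglyMeasurable w (stripMeasure ρ γ s J))
    (hW : AEStronglyMeasurable W (stripMeasure ρ γ s J))
    (hsum : ∑' n, ∫⁻ z, ‖u n z - w z‖ₑ ^ 2 + ‖F n z - W z‖ₑ ^ 2 ∂stripMeasure ρ γ s J ≠ ⊤) :
    HasStripGradient ρ β γ s J w W := by
  choose G hG hFG using hF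
  -- The candidate for `(∂ₓw, ∂_y w)`: the limit field expressed again in coordinates, through a
  -- measurable representative.
  set W' := fun z => stripCoframe ρ β s z (hW.mk W z) with hW'
  have hW'm : Measurable W' :=
    measurable_stripCoframe h.continuous hW.stronglyMeasurable_mk.measurable
  have hWW' : W =ᵐ[stripMeasure ρ γ s J] fun z => stripFrame ρ β s z (W' z) := by
    filter_upwards [hW.ae_eq_mk, absolutelyContinuous' ρ γ s J h.ae_mem_stripRegular] with z hz hz'
    rw [hz, hW', stripFrame_stripCoframe h.sq_lt_one hz'.1 (h.pos _ hz'.2).ne']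
  have hFm : ∀ n, AEStronglyMeasurable (F n) (stripMeasure ρ γ s J) := fun n =>
    (measurable_stripFrame h.continuous (hG n).1).aestronglyMeasurable.congr (hFG n).symm
  have hm₁ : ∀ n, AEMeasurable (fun z => ‖u n z - w z‖ₑ ^ 2) (stripMeasure ρ γ s J) := fun n =>
    ((hu n).sub hw).enorm.pow_const 2
  have hm₂ : ∀ n, AEMeasurable (fun z => ‖F n z - W z‖ₑ ^ 2) (stripMeasure ρ γ s J) := fun n =>
    ((hFm n).sub hW).enorm.pow_const 2
  have hs₁ : ∑' n, ∫⁻ z, ‖u n z - w z‖ₑ ^ 2 ∂stripMeasure ρ γ s J ≠ ⊤ :=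
    ne_top_of_le_ne_top hsum (ENNReal.tsum_le_tsum fun n => lintegral_mono fun z => le_self_add)
  have hs₂ : ∑' n, ∫⁻ z, ‖F n z - W z‖ₑ ^ 2 ∂stripMeasure ρ γ s J ≠ ⊤ :=
    ne_top_of_le_ne_top hsum (ENNReal.tsum_le_tsum fun n => lintegral_mono fun z => le_add_self)
  have hlim : ∀ᵐ z ∂stripMeasure ρ γ s J, Tendsto (fun n => u n z) atTop (𝓝 (w z)) :=
    ae_tendsto_of_tsum_lintegral_sq_ne_top hm₁ hs₁
  -- Used with both coordinate projections: a pointwise bound by the weighted energy density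
  -- transfers the summability of the energy errors to one partial derivative.
  have hbound : ∀ {κ : ℝ → ℝ} {π : ℝ × ℝ →ₗ[ℝ] ℝ},
      (∀ z ∈ stripRegular J, ∀ ξ : ℝ × ℝ,
        κ z.1 * (π ξ) ^ 2 ≤ stripWeight ρ γ s z * ‖stripFrame ρ β s z ξ‖ ^ 2) →
      ∑' n, ∫⁻ z in Set.univ ×ˢ J, ENNReal.ofReal (κ z.1) * ‖π (G n z) - π (W' z)‖ₑ ^ 2 ≠ ⊤ := by
    intro κ π hκ
    refine ne_top_of_le_ne_top hs₂ (ENNReal.tsum_le_tsum fun n => ?_)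
    rw [stripMeasure, lintegral_withDensity_eq_lintegral_mul₀'
      (measurable_stripWeight h.continuous).ennreal_ofReal.aemeasurable (hm₂ n)]
    refine lintegral_mono_ae ?_
    filter_upwards [h.ae_mem_stripRegular, h.absolutelyContinuous.ae_le (hFG n),
      h.absolutelyContinuous.ae_le hWW'] with z hz h1 h2
    have h3 := hκ z hz (G n z - W' z)
    rw [Pi.mul_apply, h1, h2, ← map_sub, ← map_sub, ← ofReal_norm, ← ofReal_norm,
      ← ENNReal.ofReal_pow (norm_nonneg _), ← ENNReal.ofReal_pow (norm_nonneg _)]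
    rw [← ENNReal.ofReal_mul' (by positivity), ← ENNReal.ofReal_mul' (by positivity)]
    refine ENNReal.ofReal_le_ofReal ?_
    rwa [Real.norm_eq_abs, sq_abs]
  have hr := sqrt_one_sub_sq_pos h.sq_lt_one
  have hr2 := Real.sq_sqrt (show 0 ≤ 1 - ρ ^ 2 by linarith [h.sq_lt_one])
  -- The factor `s²` of the symbol cancels against the weight, so the resulting one-dimensional
  -- weights depend on `x` alone.
  have hweight : ∀ z ∈ stripRegular J, ∀ t,
      stripWeight ρ γ s z * (s z.2 ^ 2 * ((1 - ρ ^ 2) * t)) = √(1 - ρ ^ 2) * |z.1| ^ (-γ) * t := by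
    intro z hz t
    have h1 := h.pos z.2 hz.2
    have h2 : 0 < |z.1| ^ γ := Real.rpow_pos_of_pos (abs_pos.2 hz.1) γ
    rw [stripWeight, Real.rpow_neg (abs_nonneg _)]
    field_simp
    rw [hr2]
  refine ⟨W', HasACGradient.of_summable h.isOpen h.ordConnected hG hW'm
    (κ := fun x => √(1 - ρ ^ 2) * |x| ^ (2 * β - γ)) (κ' := fun x => √(1 - ρ ^ 2) * |x| ^ (-γ))
    ((measurable_abs_rpow _).const_mul _)
    (fun x hx => mul_pos hr (Real.rpow_pos_of_pos (abs_pos.2 hx) _)) (fun a b => ?_)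
    ((measurable_abs_rpow _).const_mul _)
    (fun x hx => mul_pos hr (Real.rpow_pos_of_pos (abs_pos.2 hx) _))
    (h.absolutelyContinuous.ae_le hlim)
    (hbound (κ := fun x => √(1 - ρ ^ 2) * |x| ^ (2 * β - γ)) (π := LinearMap.fst ℝ ℝ ℝ)
      fun z hz ξ => ?_)
    (hbound (κ := fun x => √(1 - ρ ^ 2) * |x| ^ (-γ)) (π := LinearMap.snd ℝ ℝ ℝ)
      fun z hz ξ => ?_), hWW'⟩
  -- The inverse weight is a multiple of `|x|^{γ-2β}`, integrable across zero because `γ - 2β > -1`.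
  · simp only [mul_inv, ← Real.rpow_neg (abs_nonneg _), neg_sub]
    exact (intervalIntegrable_abs_rpow h.lt a b).const_mul _
  · have h1 := hweight z hz (|z.1| ^ (2 * β) * ξ.1 ^ 2)
    rw [LinearMap.fst_apply, norm_sq_stripFrame h.sq_lt_one, sub_eq_add_neg (2 * β) γ,
      Real.rpow_add (abs_pos.2 hz.1)]
    calc _ = _ := by ring
      _ = _ := h1.symm
      _ ≤ _ := mul_le_mul_of_nonneg_left (mul_le_mul_of_nonneg_left
        (le_add_of_nonneg_right (sq_nonneg _)) (sq_nonneg _)) (h.stripWeight_pos hz).le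
  · rw [LinearMap.snd_apply, norm_sq_stripFrame' h.sq_lt_one, ← hweight z hz]
    exact mul_le_mul_of_nonneg_left (mul_le_mul_of_nonneg_left
        (le_add_of_nonneg_right (sq_nonneg _)) (sq_nonneg _)) (h.stripWeight_pos hz).le

theorem memLp_testFunction (h : IsStripAdmissible ρ β γ s J) {g : ℝ × ℝ → ℝ}
    (hg : ContDiff ℝ ((⊤ : ℕ∞) : WithTop ℕ∞) g) (hg' : HasCompactSupport g)
    (hgJ : tsupport g ⊆ stripRegular J) (p : ENNReal) : MemLp g p (stripMeasure ρ γ s J) := by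
  rw [stripMeasure_eq]
  exact memLp_weight_of_isCompact h.continuousOn_stripWeight hg' hgJ
    hg.continuous.aestronglyMeasurable hg.continuous.continuousOn
    fun z hz => image_eq_zero_of_notMem_tsupport hz

theorem memLp_testFunction_gradient (h : IsStripAdmissible ρ β γ s J) {g : ℝ × ℝ → ℝ}
    (hg : ContDiff ℝ ((⊤ : ℕ∞) : WithTop ℕ∞) g) (hg' : HasCompactSupport g)
    (hgJ : tsupport g ⊆ stripRegular J) :
    MemLp (fun z => stripFrame ρ β s z (fderiv ℝ g z (1, 0), fderiv ℝ g z (0, 1))) 2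
      (stripMeasure ρ γ s J) := by
  have hc := hg.continuous_fderiv (by simp)
  have h1 : Continuous fun z => fderiv ℝ g z (1, 0) := hc.clm_apply continuous_const
  have h2 : Continuous fun z => fderiv ℝ g z (0, 1) := hc.clm_apply continuous_const
  have h3 : Continuous fun z : ℝ × ℝ => |z.1| ^ β :=
    continuous_fst.abs.rpow_const fun _ => Or.inr h.nonneg
  have h4 : Continuous fun z : ℝ × ℝ => s z.2 := h.continuous.comp continuous_snd
  have h5 : Continuous fun z =>
      stripFrame ρ β s z (fderiv ℝ g z (1, 0), fderiv ℝ g z (0, 1)) := by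
    refine (PiLp.continuous_toLp 2 _).comp (continuous_pi fun i => ?_)
    fin_cases i
    · exact h4.mul ((h3.mul h1).add (h2.const_mul ρ))
    · exact h4.mul (h2.const_mul _)
  rw [stripMeasure_eq]
  refine memLp_weight_of_isCompact h.continuousOn_stripWeight hg' hgJ
    h5.aestronglyMeasurable h5.continuousOn fun z hz => ?_
  have h0 : fderiv ℝ g z = 0 :=
    image_eq_zero_of_notMem_tsupport fun hz' => hz (tsupport_fderiv_subset ℝ hz')
  rw [h0]
  exact map_zero _

theorem isClosedDerivation (h : IsStripAdmissible ρ β γ s J) :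
    IsClosedDerivation (stripMeasure ρ γ s J) (HasStripGradient ρ β γ s J) where
  aestronglyMeasurable := by
    rintro u F ⟨G, hG, hFG⟩
    exact (measurable_stripFrame h.continuous hG.1).aestronglyMeasurable.congr hFG.symm
  congr hF huv hFG := h.congr hF huv hFG
  unique := by
    rintro u F F' ⟨G, hG, hFG⟩ ⟨G', hG', hFG'⟩
    filter_upwards [hFG, hFG', absolutelyContinuous' ρ γ s J (hG.unique h.isOpen hG')]
      with z h1 h2 h3
    rw [h1, h2, h3]
  zero := by
    refine ⟨_, (contDiff_const (c := (0 : ℝ))).hasACGradient, Eventually.of_forall fun z => ?_⟩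
    simp only [Pi.zero_apply, fderiv_fun_const, _root_.zero_apply]
    exact (map_zero _).symm
  add := by
    rintro u v F F' ⟨G, hG, hFG⟩ ⟨G', hG', hFG'⟩
    refine ⟨_, hG.add hG', ?_⟩
    filter_upwards [hFG, hFG'] with z h1 h2
    simp [h1, h2]
  smul := by
    rintro c u F ⟨G, hG, hFG⟩
    refine ⟨_, hG.smul c, ?_⟩
    filter_upwards [hFG] with z h1
    simp [h1]
  mul := by
    intro u v F F' hu hv hF hF'
    obtain ⟨u', G, hu', huu', hG, hFG⟩ := h.exists_measurable hu hF
    obtain ⟨v', G', hv', hvv', hG', hFG'⟩ := h.exists_measurable hv hF'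
    refine h.congr ⟨_, hG.mul hu' hv' hG', ae_eq_rfl⟩ (huu'.mul hvv').symm ?_
    filter_upwards [hFG, hFG', huu', hvv'] with z h1 h2 h3 h4
    simp [h1, h2, h3, h4]
  clip := by
    intro a b u F hab hu hF
    obtain ⟨u', G, hu', huu', hG, hFG⟩ := h.exists_measurable hu hF
    refine h.congr ⟨_, hG.clip h.isOpen hab hu', ae_eq_rfl⟩ ?_ ?_
    · filter_upwards [huu'] with z h1
      rw [h1]
    · filter_upwards [hFG, huu'] with z h1 h2
      rw [h1, h2]
      split_ifs
      · rfl
      · exact map_zero _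
  closed hu hF hw hW hsum := h.stripFrame_closed hu hF hw hW hsum
  separating := by
    intro f hf hzero
    rw [stripMeasure_eq] at hf ⊢
    refine ae_eq_zero_of_forall_testFunction (isOpen_stripRegular h.isOpen)
      (measurable_stripWeight h.continuous) (fun z hz => h.stripWeight_pos hz) hf
      fun g hg hg' hgJ => ?_
    rw [← stripMeasure_eq]
    exact hzero g _ ⟨_, (hg.of_le (by simp)).hasACGradient, ae_eq_rfl⟩
      (h.memLp_testFunction hg hg' hgJ 2) (h.memLp_testFunction hg hg' hgJ ⊤)
      (h.memLp_testFunction_gradient hg hg' hgJ)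

theorem stripGamma_eq (hρ : ρ ^ 2 < 1) (u v : ℝ × ℝ → ℝ) (z : ℝ × ℝ) : stripGamma ρ β s J u v z =
    inner ℝ (stripFrame ρ β s z (acGradient J u z)) (stripFrame ρ β s z (acGradient J v z)) := by
  rw [inner_stripFrame hρ]
  simp [stripGamma, tcSymbol, acDifferential]

theorem isDirichletIntegral (h : IsStripAdmissible ρ β γ s J) :
    IsDirichletIntegral (stripMeasure ρ γ s J) (HasStripGradient ρ β γ s J)
      (stripDomain ρ β γ s J) (stripGamma ρ β s J) where
  derivation := h.isClosedDerivation
  eq_inner := by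
    rintro u v F F' ⟨G, hG, hFG⟩ ⟨G', hG', hFG'⟩
    filter_upwards [hFG, hFG', absolutelyContinuous' ρ γ s J
      (hG.unique h.isOpen (hasACGradient_acGradient ⟨G, hG⟩)), absolutelyContinuous' ρ γ s J
      (hG'.unique h.isOpen (hasACGradient_acGradient ⟨G', hG'⟩))] with z h1 h2 h3 h4
    rw [stripGamma_eq h.sq_lt_one, h1, h2, h3, h4]
  mem_iff := by
    intro u
    -- `Γ(u,u)` is the squared norm of the frame gradient built from the chosen `acGradient`; any
    -- other gradient agrees with it almost everywhere.
    have key : ∀ {G}, HasACGradient J u G → (Integrable (stripGamma ρ β s J u u)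
        (stripMeasure ρ γ s J) ↔ MemLp (fun z => stripFrame ρ β s z (acGradient J u z)) 2
        (stripMeasure ρ γ s J)) := by
      intro G hG
      rw [memLp_two_iff_integrable_sq_norm (measurable_stripFrame h.continuous
        (hasACGradient_acGradient ⟨G, hG⟩).1).aestronglyMeasurable]
      refine integrable_congr (Eventually.of_forall fun z => ?_)
      rw [stripGamma_eq h.sq_lt_one, real_inner_self_eq_norm_sq]
    constructor
    · rintro ⟨hu, ⟨G, hG⟩, hi⟩
      exact ⟨hu, _, ⟨_, hasACGradient_acGradient ⟨G, hG⟩, ae_eq_rfl⟩, (key hG).1 hi⟩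
    · rintro ⟨hu, F, ⟨G, hG, hFG⟩, hF⟩
      refine ⟨hu, ⟨G, hG⟩, (key hG).2 (hF.ae_eq ?_)⟩
      filter_upwards [hFG, absolutelyContinuous' ρ γ s J
        (hG.unique h.isOpen (hasACGradient_acGradient ⟨G, hG⟩))] with z h1 h2
      rw [h1, h2]

end IsStripAdmissible

end Strip

/-! ### The CEV form -/

section Line

variable {σ β : ℝ}

/-- `F` is the gradient of `u` in the orthonormal frame of the CEV metric. -/
def HasCevGradient (σ β : ℝ) (u F : ℝ → ℝ) : Prop :=
  ∃ g, Measurable g ∧ HasACDerivOn Set.univ u g ∧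
    F =ᵐ[cevMeasure β] fun x => σ * |x| ^ β * g x

theorem hasACDerivOn_acDeriv {u : ℝ → ℝ} (h : ∃ g, Measurable g ∧ HasACDerivOn Set.univ u g) :
    Measurable (acDeriv u) ∧ HasACDerivOn Set.univ u (acDeriv u) := by
  rw [acDeriv, dif_pos h]
  exact h.choose_spec

theorem measurable_cevWeight (β : ℝ) : Measurable fun x : ℝ => 1 / |x| ^ (2 * β) :=
  (measurable_abs_rpow _).const_div 1

theorem cevWeight_pos (β : ℝ) : ∀ x ∈ ({0}ᶜ : Set ℝ), 0 < 1 / |x| ^ (2 * β) := fun _ hx =>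
  one_div_pos.2 (Real.rpow_pos_of_pos (abs_pos.2 hx) _)

theorem ae_ne_zero : ∀ᵐ x : ℝ, x ≠ 0 := by
  simp [ae_iff]

theorem cevMeasure_eq (β : ℝ) : cevMeasure β = ((volume : Measure ℝ).restrict {0}ᶜ).withDensity
    fun x => ENNReal.ofReal (1 / |x| ^ (2 * β)) := by
  rw [cevMeasure, Measure.restrict_eq_self_of_ae_mem]
  exact ae_ne_zero

theorem volume_absolutelyContinuous_cevMeasure (β : ℝ) : volume ≪ cevMeasure β := by
  refine withDensity_absolutelyContinuous' (measurable_cevWeight β).ennreal_ofReal.aemeasurable ?_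
  filter_upwards [ae_ne_zero] with x hx
  simpa using Real.rpow_pos_of_pos (abs_pos.2 hx) (2 * β)

theorem cevMeasure_absolutelyContinuous (β : ℝ) : cevMeasure β ≪ volume :=
  withDensity_absolutelyContinuous _ _

theorem ae_restrict_univ_of_cevMeasure {p : ℝ → Prop} (h : ∀ᵐ x ∂cevMeasure β, p x) :
    ∀ᵐ x ∂volume.restrict Set.univ, p x := by
  rw [Measure.restrict_univ]
  exact (volume_absolutelyContinuous_cevMeasure β).ae_le h

theorem HasACDerivOn.unique_cevMeasure {u g g' : ℝ → ℝ} (h : HasACDerivOn Set.univ u g)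
    (h' : HasACDerivOn Set.univ u g') : g =ᵐ[cevMeasure β] g' := by
  have := h.unique isOpen_univ h'
  rw [Measure.restrict_univ] at this
  exact (cevMeasure_absolutelyContinuous β).ae_le this

theorem HasCevGradient.congr {u v F G : ℝ → ℝ} (hF : HasCevGradient σ β u F)
    (huv : u =ᵐ[cevMeasure β] v) (hFG : F =ᵐ[cevMeasure β] G) : HasCevGradient σ β v G := by
  obtain ⟨g, hg, hug, hFg⟩ := hF
  exact ⟨g, hg, hug.congr (ae_restrict_univ_of_cevMeasure huv) ae_eq_rfl, hFG.symm.trans hFg⟩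

theorem HasCevGradient.exists_measurable {u F : ℝ → ℝ} (hF : HasCevGradient σ β u F)
    (hu : AEStronglyMeasurable u (cevMeasure β)) : ∃ v g, Measurable v ∧ u =ᵐ[cevMeasure β] v ∧
      Measurable g ∧ HasACDerivOn Set.univ v g ∧
      F =ᵐ[cevMeasure β] fun x => σ * |x| ^ β * g x := by
  obtain ⟨g, hg, hug, hFg⟩ := hF
  exact ⟨hu.mk u, g, hu.stronglyMeasurable_mk.measurable, hu.ae_eq_mk, hg,
    hug.congr (ae_restrict_univ_of_cevMeasure hu.ae_eq_mk) ae_eq_rfl, hFg⟩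

theorem measurable_cevFrame {g : ℝ → ℝ} (hg : Measurable g) :
    Measurable fun x => σ * |x| ^ β * g x :=
  ((measurable_abs_rpow β).const_mul σ).mul hg

/-- The factor `|x|^{2β}` of the symbol cancels the density `|x|^{-2β}`, so the derivatives converge
in unweighted `L²(dx)` and the constant `κ = σ²` serves. -/
theorem cevFrame_closed (hσ : 0 < σ) {u F : ℕ → ℝ → ℝ} {w W : ℝ → ℝ}
    (hu : ∀ n, AEStronglyMeasurable (u n) (cevMeasure β))
    (hF : ∀ n, HasCevGradient σ β (u n) (F n))
    (hw : AEStronglyMeasurable w (cevMeasure β)) (hW : AEStronglyMeasurable W (cevMeasure β))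
    (hsum : ∑' n, ∫⁻ z, ‖u n z - w z‖ₑ ^ 2 + ‖F n z - W z‖ₑ ^ 2 ∂cevMeasure β ≠ ⊤) :
    HasCevGradient σ β w W := by
  choose g hg hug hFg using hF
  set W' := fun x => (σ * |x| ^ β)⁻¹ * hW.mk W x with hW'
  have hW'm : Measurable W' :=
    ((measurable_abs_rpow β).const_mul σ).inv.mul hW.stronglyMeasurable_mk.measurable
  have hWW' : W =ᵐ[cevMeasure β] fun x => σ * |x| ^ β * W' x := by
    filter_upwards [hW.ae_eq_mk, cevMeasure_absolutelyContinuous β ae_ne_zero] with x hx hx'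
    rw [hx, hW', mul_inv_cancel_left₀
      (mul_ne_zero hσ.ne' (Real.rpow_pos_of_pos (abs_pos.2 hx') β).ne')]
  have hFm : ∀ n, AEStronglyMeasurable (F n) (cevMeasure β) := fun n =>
    (measurable_cevFrame (hg n)).aestronglyMeasurable.congr (hFg n).symm
  have hm₁ : ∀ n, AEMeasurable (fun z => ‖u n z - w z‖ₑ ^ 2) (cevMeasure β) := fun n =>
    ((hu n).sub hw).enorm.pow_const 2
  have hm₂ : ∀ n, AEMeasurable (fun z => ‖F n z - W z‖ₑ ^ 2) (cevMeasure β) := fun n =>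
    ((hFm n).sub hW).enorm.pow_const 2
  have hs₁ : ∑' n, ∫⁻ z, ‖u n z - w z‖ₑ ^ 2 ∂cevMeasure β ≠ ⊤ :=
    ne_top_of_le_ne_top hsum (ENNReal.tsum_le_tsum fun n => lintegral_mono fun z => le_self_add)
  have hs₂ : ∑' n, ∫⁻ z, ‖F n z - W z‖ₑ ^ 2 ∂cevMeasure β ≠ ⊤ :=
    ne_top_of_le_ne_top hsum (ENNReal.tsum_le_tsum fun n => lintegral_mono fun z => le_add_self)
  have hlim : ∀ᵐ x ∂volume.restrict Set.univ, Tendsto (fun n => u n x) atTop (𝓝 (w x)) :=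
    ae_restrict_univ_of_cevMeasure (ae_tendsto_of_tsum_lintegral_sq_ne_top hm₁ hs₁)
  refine ⟨W', hW'm, HasACDerivOn.of_tendsto_sq isOpen_univ Set.ordConnected_univ hug
    (fun n => (hg n).aemeasurable) hW'm.aemeasurable (κ := fun _ => σ ^ 2) measurable_const
    (Eventually.of_forall fun _ => by positivity) (fun a _ b _ => by simp) hlim ?_, hWW'⟩
  refine (ENNReal.tendsto_atTop_zero_of_tsum_ne_top hs₂).congr fun n => ?_
  rw [Measure.restrict_univ, cevMeasure, lintegral_withDensity_eq_lintegral_mul₀'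
    (measurable_cevWeight β).ennreal_ofReal.aemeasurable (hm₂ n)]
  refine lintegral_congr_ae ?_
  filter_upwards [ae_ne_zero, (volume_absolutelyContinuous_cevMeasure β).ae_le (hFg n),
    (volume_absolutelyContinuous_cevMeasure β).ae_le hWW'] with x hx h1 h2
  have h3 := Real.rpow_pos_of_pos (abs_pos.2 hx) β
  rw [Pi.mul_apply, h1, h2, ← mul_sub, ← ofReal_norm, ← ofReal_norm,
    ← ENNReal.ofReal_pow (norm_nonneg _), ← ENNReal.ofReal_pow (norm_nonneg _),
    ← ENNReal.ofReal_mul' (by positivity), ← ENNReal.ofReal_mul' (by positivity), norm_mul,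
    Real.norm_of_nonneg (by positivity : 0 ≤ σ * |x| ^ β), abs_rpow_two_mul]
  congr 1
  field_simp

theorem isClosedDerivation_cev (hσ : 0 < σ) (hβ : 0 ≤ β) :
    IsClosedDerivation (cevMeasure β) (HasCevGradient σ β) where
  aestronglyMeasurable := by
    rintro u F ⟨g, hg, hug, hFg⟩
    exact (measurable_cevFrame hg).aestronglyMeasurable.congr hFg.symm
  congr hF huv hFG := hF.congr huv hFG
  unique := by
    rintro u F F' ⟨g, hg, hug, hFg⟩ ⟨g', hg', hug', hFg'⟩
    filter_upwards [hFg, hFg', hug.unique_cevMeasure hug'] with x h1 h2 h3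
    rw [h1, h2, h3]
  zero := by
    refine ⟨_, measurable_deriv _, (contDiff_const (c := (0 : ℝ))).hasACDerivOn,
      Eventually.of_forall fun x => ?_⟩
    simp
  add := by
    rintro u v F F' ⟨g, hg, hug, hFg⟩ ⟨g', hg', hug', hFg'⟩
    refine ⟨_, hg.add hg', hug.add hug', ?_⟩
    filter_upwards [hFg, hFg'] with x h1 h2
    simp [h1, h2, mul_add]
  smul := by
    rintro c u F ⟨g, hg, hug, hFg⟩
    refine ⟨_, hg.const_mul c, hug.const_mul c, ?_⟩
    filter_upwards [hFg] with x h1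
    simp only [Pi.smul_apply, h1, smul_eq_mul]
    ring
  mul := by
    intro u v F F' hu hv hF hF'
    obtain ⟨u', g, hu', huu', hg, hug, hFg⟩ := hF.exists_measurable hu
    obtain ⟨v', g', hv', hvv', hg', hug', hFg'⟩ := hF'.exists_measurable hv
    refine HasCevGradient.congr ⟨_, (hu'.mul hg').add (hv'.mul hg), hug.mul hug', ae_eq_rfl⟩
      (huu'.mul hvv').symm ?_
    filter_upwards [hFg, hFg', huu', hvv'] with x h1 h2 h3 h4
    simp only [h1, h2, h3, h4, Pi.add_apply, Pi.mul_apply, smul_eq_mul]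
    ring
  clip := by
    intro a b u F hab hu hF
    obtain ⟨u', g, hu', huu', hg, hug, hFg⟩ := hF.exists_measurable hu
    refine HasCevGradient.congr ⟨fun x => if a < u' x ∧ u' x < b then g x else 0,
      Measurable.ite ((measurableSet_lt measurable_const hu').inter
      (measurableSet_lt hu' measurable_const)) hg measurable_const, hug.clip isOpen_univ hab,
      ae_eq_rfl⟩ ?_ ?_
    · filter_upwards [huu'] with x h1
      rw [h1]
    · filter_upwards [hFg, huu'] with x h1 h2
      rw [h1, h2]
      split_ifs
      · rfl
      · exact mul_zero _
  closed hu hF hw hW hsum := cevFrame_closed hσ hu hF hw hW hsum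
  separating := by
    intro f hf hzero
    have hU : IsOpen ({0}ᶜ : Set ℝ) := isOpen_compl_singleton
    have hwc : ContinuousOn (fun x : ℝ => 1 / |x| ^ (2 * β)) {0}ᶜ := by
      refine continuousOn_const.div (continuous_abs.continuousOn.rpow_const fun x hx =>
        Or.inl (abs_pos.2 hx).ne') fun x hx => ?_
      exact (one_div_pos.1 (cevWeight_pos β x hx)).ne'
    rw [cevMeasure_eq] at hf ⊢
    refine ae_eq_zero_of_forall_testFunction hU (measurable_cevWeight β) (cevWeight_pos β) hf
      fun g hg hg' hgU => ?_
    have h1 : ∀ p, MemLp g p (cevMeasure β) := fun p => by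
      rw [cevMeasure_eq]
      exact memLp_weight_of_isCompact hwc hg' hgU hg.continuous.aestronglyMeasurable
        hg.continuous.continuousOn fun z hz => image_eq_zero_of_notMem_tsupport hz
    rw [← cevMeasure_eq]
    refine hzero g _ ⟨_, measurable_deriv g, (hg.of_le (by simp)).hasACDerivOn, ae_eq_rfl⟩
      (h1 2) (h1 ⊤) ?_
    have h2 : Continuous fun x => σ * |x| ^ β * deriv g x :=
      (continuous_const.mul (continuous_abs.rpow_const fun _ => Or.inr hβ)).mul
        (hg.continuous_deriv (by simp))
    rw [cevMeasure_eq]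
    refine memLp_weight_of_isCompact hwc hg' hgU h2.aestronglyMeasurable h2.continuousOn
      fun x hx => ?_
    rw [image_eq_zero_of_notMem_tsupport fun hx' => hx (tsupport_deriv_subset hx'), mul_zero]

theorem cevGamma_eq (u v : ℝ → ℝ) (x : ℝ) : cevGamma σ β u v x =
    inner ℝ (σ * |x| ^ β * acDeriv u x) (σ * |x| ^ β * acDeriv v x) := by
  simp only [cevGamma, cevSymbol, acDifferentialLine, abs_rpow_two_mul]
  simp
  ring

theorem isDirichletIntegral_cev (hσ : 0 < σ) (hβ : 0 ≤ β) :
    IsDirichletIntegral (cevMeasure β) (HasCevGradient σ β) (cevDomain σ β) (cevGamma σ β) where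
  derivation := isClosedDerivation_cev hσ hβ
  eq_inner := by
    rintro u v F F' ⟨g, hg, hug, hFg⟩ ⟨g', hg', hug', hFg'⟩
    filter_upwards [hFg, hFg', hug.unique_cevMeasure (hasACDerivOn_acDeriv ⟨g, hg, hug⟩).2,
      hug'.unique_cevMeasure (hasACDerivOn_acDeriv ⟨g', hg', hug'⟩).2] with x h1 h2 h3 h4
    rw [cevGamma_eq, h1, h2, h3, h4]
  mem_iff := by
    intro u
    have key : ∀ {g}, Measurable g → HasACDerivOn Set.univ u g → (Integrable (cevGamma σ β u u)
        (cevMeasure β) ↔ MemLp (fun x => σ * |x| ^ β * acDeriv u x) 2 (cevMeasure β)) := by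
      intro g hg hug
      rw [memLp_two_iff_integrable_sq_norm (measurable_cevFrame
        (hasACDerivOn_acDeriv ⟨g, hg, hug⟩).1).aestronglyMeasurable]
      refine integrable_congr (Eventually.of_forall fun x => ?_)
      rw [cevGamma_eq, real_inner_self_eq_norm_sq]
    constructor
    · rintro ⟨hu, ⟨g, hg, hug⟩, hi⟩
      have := hasACDerivOn_acDeriv ⟨g, hg, hug⟩
      exact ⟨hu, _, ⟨_, this.1, this.2, ae_eq_rfl⟩, (key hg hug).1 hi⟩
    · rintro ⟨hu, F, ⟨g, hg, hug, hFg⟩, hF⟩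
      refine ⟨hu, ⟨g, hg, hug⟩, (key hg hug).2 (hF.ae_eq ?_)⟩
      filter_upwards [hFg, hug.unique_cevMeasure (hasACDerivOn_acDeriv ⟨g, hg, hug⟩).2]
        with x h1 h2
      rw [h1, h2]

end Line

/-! ### Riemannian gradients -/

section Gradient

/-- If `X_ξ` represents the covector `ξ` and `q(ξ,η) = ξ(X_η)`, then `q` is the inner product of
the gradients. -/
theorem isGradientInnerProductOn_of_sharp {E : Type*} [NormedAddCommGroup E] [NormedSpace ℝ E]
    [MeasurableSpace E] {U : Set E} {g : E → E → E → ℝ}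
    {q : E → (E →L[ℝ] ℝ) → (E →L[ℝ] ℝ) → ℝ} {d : (E → ℝ) → E → E →L[ℝ] ℝ} {μ : Measure E}
    {D : Set (E → ℝ)} (hg : IsRiemannianMetricOn U g)
    (sharp : E → (E →L[ℝ] ℝ) → E) (h : ∀ z ∈ U, ∀ ξ w, g z (sharp z ξ) w = ξ w)
    (hq : ∀ z ∈ U, ∀ ξ η, q z ξ η = ξ (sharp z η)) :
    IsGradientInnerProductOn U g q d (fun u v z => q z (d u z) (d v z)) μ D where
  isMetric := hg
  classical z hz u v _ _ := ⟨_, _, h z hz _, h z hz _, by rw [h z hz, hq z hz]⟩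
  onDomain _ _ _ _ := Eventually.of_forall fun z hz =>
    ⟨_, _, h z hz _, h z hz _, by rw [h z hz, hq z hz]⟩

theorem clm_apply_eq (ξ : ℝ × ℝ →L[ℝ] ℝ) (w : ℝ × ℝ) :
    ξ w = w.1 * ξ (1, 0) + w.2 * ξ (0, 1) := by
  conv_lhs => rw [show w = w.1 • ((1, 0) : ℝ × ℝ) + w.2 • ((0, 1) : ℝ × ℝ) by ext <;> simp]
  rw [map_add, map_smul, map_smul, smul_eq_mul, smul_eq_mul]

theorem contDiffOn_abs_rpow (r : ℝ) :
    ContDiffOn ℝ ((⊤ : ℕ∞) : WithTop ℕ∞) (fun x : ℝ => |x| ^ r) {x | x ≠ 0} := fun _ hx =>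
  ((contDiffAt_abs hx).rpow_const_of_ne (abs_pos.2 hx).ne').contDiffWithinAt

/-- The metric `s(y)⁻² g̃` on a strip. -/
def stripMetric (ρ β : ℝ) (s : ℝ → ℝ) (z v w : ℝ × ℝ) : ℝ :=
  1 / (1 - ρ ^ 2) * (v.1 * w.1 / (s z.2 ^ 2 * |z.1| ^ (2 * β)) -
    ρ * (v.1 * w.2 + v.2 * w.1) / (s z.2 ^ 2 * |z.1| ^ β) + v.2 * w.2 / s z.2 ^ 2)

/-- The inverse matrix of `stripMetric` applied to `ξ`, that is, the Riemannian gradient attached to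
a covector. -/
def stripSharp (ρ β : ℝ) (s : ℝ → ℝ) (z : ℝ × ℝ) (ξ : ℝ × ℝ →L[ℝ] ℝ) : ℝ × ℝ :=
  (s z.2 ^ 2 * (|z.1| ^ (2 * β) * ξ (1, 0) + ρ * |z.1| ^ β * ξ (0, 1)),
    s z.2 ^ 2 * (ρ * |z.1| ^ β * ξ (1, 0) + ξ (0, 1)))

variable {ρ β γ : ℝ} {s : ℝ → ℝ} {J : Set ℝ}

theorem IsStripAdmissible.isRiemannianMetricOn (h : IsStripAdmissible ρ β γ s J)
    (hs : ContDiff ℝ ((⊤ : ℕ∞) : WithTop ℕ∞) s) :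
    IsRiemannianMetricOn (stripRegular J) (stripMetric ρ β s) where
  isOpen := isOpen_stripRegular h.isOpen
  add_left z hz v v' w := by
    simp only [stripMetric, Prod.fst_add, Prod.snd_add]
    ring
  smul_left z hz c v w := by
    simp only [stripMetric, Prod.smul_fst, Prod.smul_snd, smul_eq_mul]
    ring
  symm z hz v w := by
    simp only [stripMetric]
    ring
  pos z hz v hv := by
    have h1 := h.pos z.2 hz.2
    have h2 : 0 < |z.1| ^ β := Real.rpow_pos_of_pos (abs_pos.2 hz.1) β
    have h3 : 0 < 1 - ρ ^ 2 := by linarith [h.sq_lt_one]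
    -- Completing the square in `v.1` makes positivity visible.
    have key : stripMetric ρ β s z v v = 1 / ((1 - ρ ^ 2) * s z.2 ^ 2) *
        ((v.1 / |z.1| ^ β - ρ * v.2) ^ 2 + (1 - ρ ^ 2) * v.2 ^ 2) := by
      rw [stripMetric, abs_rpow_two_mul]
      field_simp
      ring
    rw [key]
    refine mul_pos (by positivity) ?_
    by_cases hv2 : v.2 = 0
    · have hv1 : v.1 ≠ 0 := fun hv1 => hv (Prod.ext hv1 hv2)
      rw [hv2]
      simp only [mul_zero, sub_zero, ne_eq, OfNat.ofNat_ne_zero, not_false_eq_true, zero_pow,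
        add_zero]
      positivity
    · positivity
  smooth v w := by
    have h1 : ∀ r : ℝ, ContDiffOn ℝ ((⊤ : ℕ∞) : WithTop ℕ∞) (fun z : ℝ × ℝ => |z.1| ^ r)
        (stripRegular J) := fun r =>
      (contDiffOn_abs_rpow r).comp contDiff_fst.contDiffOn fun z hz => hz.1
    have h2 : ContDiffOn ℝ ((⊤ : ℕ∞) : WithTop ℕ∞) (fun z : ℝ × ℝ => s z.2 ^ 2)
        (stripRegular J) := ((hs.comp contDiff_snd).pow 2).contDiffOn
    have h3 : ∀ r : ℝ, ∀ z ∈ stripRegular J, |z.1| ^ r ≠ 0 := fun r z hz =>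
      (Real.rpow_pos_of_pos (abs_pos.2 hz.1) r).ne'
    have h4 : ∀ z ∈ stripRegular J, s z.2 ^ 2 ≠ 0 := fun z hz => (pow_pos (h.pos _ hz.2) 2).ne'
    exact contDiffOn_const.mul (((contDiffOn_const.div (h2.mul (h1 _)) fun z hz =>
      mul_ne_zero (h4 z hz) (h3 _ z hz)).sub (contDiffOn_const.div (h2.mul (h1 _)) fun z hz =>
      mul_ne_zero (h4 z hz) (h3 _ z hz))).add (contDiffOn_const.div h2 h4))

theorem IsStripAdmissible.isGradientInnerProductOn (h : IsStripAdmissible ρ β γ s J)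
    (hs : ContDiff ℝ ((⊤ : ℕ∞) : WithTop ℕ∞) s) :
    IsGradientInnerProductOn (stripRegular J) (stripMetric ρ β s)
      (fun z ξ η => s z.2 ^ 2 * tcSymbol ρ β z ξ η) (acDifferential J) (stripGamma ρ β s J)
      (stripMeasure ρ γ s J) (stripDomain ρ β γ s J) := by
  refine isGradientInnerProductOn_of_sharp (h.isRiemannianMetricOn hs) (stripSharp ρ β s)
    (fun z hz ξ w => ?_) fun z hz ξ η => ?_
  · have h1 := h.pos z.2 hz.2
    have h2 : 0 < |z.1| ^ β := Real.rpow_pos_of_pos (abs_pos.2 hz.1) β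
    have h3 : 1 - ρ ^ 2 ≠ 0 := by linarith [h.sq_lt_one]
    rw [clm_apply_eq ξ w]
    simp only [stripMetric, stripSharp, abs_rpow_two_mul]
    field_simp
    ring
  · rw [clm_apply_eq ξ]
    simp only [tcSymbol, stripSharp]
    ring

end Gradient

/-! ### The CEV metric and its gradient -/

section Cev

variable {σ β : ℝ}

theorem isRiemannianMetricOn_cev (hσ : 0 < σ) :
    IsRiemannianMetricOn {x | x ≠ 0} (cevMetric σ β) where
  isOpen := isOpen_ne
  add_left x hx v v' w := by
    simp only [cevMetric]
    ring
  smul_left x hx c v w := by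
    simp only [cevMetric, smul_eq_mul]
    ring
  symm x hx v w := by
    simp only [cevMetric]
    ring
  pos x hx v hv := by
    have h1 : 0 < |x| ^ (2 * β) := Real.rpow_pos_of_pos (abs_pos.2 hx) _
    exact div_pos (mul_self_pos.2 hv) (by positivity)
  smooth v w := contDiffOn_const.div (contDiffOn_const.mul (contDiffOn_abs_rpow _)) fun _ hx =>
    mul_ne_zero (by positivity) (Real.rpow_pos_of_pos (abs_pos.2 hx) _).ne'

theorem isGradientInnerProductOn_cev (hσ : 0 < σ) :
    IsGradientInnerProductOn {x : ℝ | x ≠ 0} (cevMetric σ β) (cevSymbol σ β)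
      acDifferentialLine (cevGamma σ β) (cevMeasure β) (cevDomain σ β) := by
  have hlin : ∀ (ξ : ℝ →L[ℝ] ℝ) (w : ℝ), ξ w = w * ξ 1 := fun ξ w => by
    rw [← smul_eq_mul, ← map_smul, smul_eq_mul, mul_one]
  refine isGradientInnerProductOn_of_sharp (isRiemannianMetricOn_cev hσ)
    (fun x ξ => σ ^ 2 * |x| ^ (2 * β) * ξ 1) (fun x hx ξ w => ?_) fun x hx ξ η => ?_
  · have h1 : 0 < |x| ^ (2 * β) := Real.rpow_pos_of_pos (abs_pos.2 hx) _
    rw [hlin ξ w, cevMetric]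
    field_simp
  · rw [hlin ξ, cevSymbol]
    ring

end Cev

/-! ### The SABR forms as instances of the strip form -/

section Identification

theorem stripMeasure_one (ρ β : ℝ) (j : ℕ) :
    stripMeasure ρ (β * (1 + j)) (fun _ => 1) Set.univ = tcMeasure ρ β j := by
  simp [stripMeasure, stripWeight, tcMeasure]

theorem stripGamma_one (ρ β : ℝ) : stripGamma ρ β (fun _ => 1) Set.univ = tcGamma ρ β := by
  ext u v z
  simp [stripGamma, tcGamma]

theorem stripDomain_one (ρ β : ℝ) (j : ℕ) :
    stripDomain ρ β (β * (1 + j)) (fun _ => 1) Set.univ = tcDomain ρ β j := by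
  rw [stripDomain, tcDomain, stripMeasure_one, stripGamma_one]

/-- With `γ = β(1+j)` the critical exponent `γ - 2β` is `-β` for `j = 0` and `0` for `j = 1`. -/
theorem isStripAdmissible {ρ β : ℝ} (hρ : -1 < ρ) (hρ' : ρ < 1) (hβ : 0 ≤ β) {j : ℕ}
    (hj : (j = 0 ∧ β < 1) ∨ (j = 1 ∧ β < 1 / 2)) {s : ℝ → ℝ} {J : Set ℝ} (hJ : IsOpen J)
    (hJ' : J.OrdConnected) (hs : Continuous s) (hs₀ : ∀ y ∈ J, 0 < s y) :
    IsStripAdmissible ρ β (β * (1 + j)) s J where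
  sq_lt_one := (sq_lt_one_iff_abs_lt_one ρ).2 (abs_lt.2 ⟨hρ, hρ'⟩)
  nonneg := hβ
  lt := by
    rcases hj with ⟨rfl, h⟩ | ⟨rfl, h⟩ <;> norm_num <;> linarith
  isOpen := hJ
  ordConnected := hJ'
  continuous := hs
  pos := hs₀

end Identification

end

theorem mainTheorem12 (ρ β σ : ℝ) (hρ : -1 < ρ) (hρ' : ρ < 1) (hβ : 0 ≤ β) (hσ : 0 < σ) :
    (∀ j : ℕ, (j = 0 ∧ β < 1) ∨ (j = 1 ∧ β < 1 / 2) →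
      HasEnergyMeasure (sabrMeasure ρ β j) (sabrDomain ρ β j)
        (energyForm (sabrMeasure ρ β j) (sabrGamma ρ β)) (sabrGamma ρ β) ∧
      IsGradientInnerProductOn {z : ℝ × ℝ | z.1 ≠ 0 ∧ 0 < z.2} (sabrMetric ρ β) (sabrSymbol ρ β)
        (acDifferential (Set.Ioi 0)) (sabrGamma ρ β) (sabrMeasure ρ β j) (sabrDomain ρ β j)) ∧
    (∀ j : ℕ, (j = 0 ∧ β < 1) ∨ (j = 1 ∧ β < 1 / 2) →
      HasEnergyMeasure (tcMeasure ρ β j) (tcDomain ρ β j)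
        (energyForm (tcMeasure ρ β j) (tcGamma ρ β)) (tcGamma ρ β) ∧
      IsGradientInnerProductOn {z : ℝ × ℝ | z.1 ≠ 0} (tcMetric ρ β) (tcSymbol ρ β)
        (acDifferential Set.univ) (tcGamma ρ β) (tcMeasure ρ β j) (tcDomain ρ β j)) ∧
    (β < 1 / 2 →
      HasEnergyMeasure (cevMeasure β) (cevDomain σ β)
        (energyForm (cevMeasure β) (cevGamma σ β)) (cevGamma σ β) ∧
      IsGradientInnerProductOn {x : ℝ | x ≠ 0} (cevMetric σ β) (cevSymbol σ β)
        acDifferentialLine (cevGamma σ β) (cevMeasure β) (cevDomain σ β)) := by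
  have hreg' : stripRegular Set.univ = {z : ℝ × ℝ | z.1 ≠ 0} := by
    ext z
    simp [stripRegular]
  have hmetric : stripMetric ρ β (fun _ => 1) = tcMetric ρ β := by
    ext z v w
    simp [stripMetric, tcMetric]
  refine ⟨fun j hj => ?_, fun j hj => ?_, fun _ =>
    ⟨(isDirichletIntegral_cev hσ hβ).hasEnergyMeasure, isGradientInnerProductOn_cev hσ⟩⟩
  · have h : IsStripAdmissible ρ β (β * (1 + j)) id (Set.Ioi 0) :=
      isStripAdmissible hρ hρ' hβ hj isOpen_Ioi Set.ordConnected_Ioi continuous_id fun y hy => hy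
    -- For `s = id` on `(0,∞)` the strip objects are the SABR objects by definition, so nothing has
    -- to be rewritten; for `s = 1` below, the factors `1²` must be removed.
    exact ⟨h.isDirichletIntegral.hasEnergyMeasure, h.isGradientInnerProductOn contDiff_id⟩
  · have h : IsStripAdmissible ρ β (β * (1 + j)) (fun _ => 1) Set.univ :=
      isStripAdmissible hρ hρ' hβ hj isOpen_univ Set.ordConnected_univ continuous_const
        fun y _ => one_pos
    have h1 := h.isDirichletIntegral.hasEnergyMeasure
    have h2 := h.isGradientInnerProductOn contDiff_const
    rw [stripMeasure_one, stripDomain_one, stripGamma_one] at h1 h2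
    rw [hreg', hmetric] at h2
    simp only [one_pow, one_mul] at h2
    exact ⟨h1, h2⟩
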